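/- Throughout, $\log$ is the base-2 logarithm, $\Delta^n$ is the probability simplex in $\mathbb{R}^n$, and for $P\in\Delta^n$, $v\in\mathbb{R}^n$ put $\mathrm{Var}_P(v)=\sum_j P(j)\bigl(v(j)-\sum_k P(k)v(k)\bigr)^2$. Online learning. In each round $t=1,\dots,T$ a player with $n\ge 1$ actions chooses $x^t\in\Delta^n$ as a function of the loss vectors $\ell^1,\dots,\ell^{t-1}$ seen so far, and then observes $\ell^t\in[0,1]^n$; set $\ell^0=0$. The regret is $\mathrm{Reg}_T=\sum_{t=1}^T\langle x^t,\ell^t\rangle-\min_{j}\sum_{t=1}^T\ell^t(j)$. Optimistic Hedge with step size $\eta$ plays $x^1=(1/n,\dots,1/n)$ and $$x^{t+1}(j)=\frac{x^t(j)\exp(-\eta(2\ell^t(j)-\ell^{t-1}(j)))}{\sum_k x^t(k)\exp(-\eta(2\ell^t(k)-\ell^{t-1}(k)))}.$$ The algorithm. For constants $C,C'>0$, a number of players $m\ge1$ and a horizon $T\ge 2$, let $\mathcal{A}=\mathcal{A}_{C,C',m,T}$ be the following algorithm for a player with $n$ actions. Run Optimistic Hedge with step size $\eta=\frac{1}{C\,m\log^4T}$.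 Let $T_0\ge4$ be the first time (if there is one) at which $$\sum_{t=1}^{T_0}\mathrm{Var}_{x^t}(\ell^t-\ell^{t-1})>\frac12\sum_{t=1}^{T_0}\mathrm{Var}_{x^t}(\ell^{t-1})+C'\lceil\log T\rceil^5 .$$ From round $T_0+1$ on, run Optimistic Hedge afresh (starting at the uniform distribution, on the losses $\ell^{T_0+1},\ell^{T_0+2},\dots$) with step size $\eta'=\sqrt{\log n/T}$. Games. In a game with $m$ players, player $i$ has $n_i\ge1$ actions and a loss function $\mathcal{L}_i:\prod_k[n_k]\to[0,1]$. If the players use the mixed strategies $x_1^t,\dots,x_m^t$ in round $t$, player $i$ observes the loss vector $\ell_i^t(j)=\mathbb{E}_{a_{-i}\sim x_{-i}^t}[\mathcal{L}_i(j,a_{-i})]$. Write $\mathrm{Reg}_{i,T}$ for the regret of player $i$. Statement. There are universal constants $C,C',K>0$ such that for all integers $m\ge1$ and $T\ge2$ the algorithm $\mathcal{A}=\mathcal{A}_{C,C',m,T}$ satisfies: 1. In every game with $m$ players and $n_1,\dots,n_m\ge1$ actions, if all players use $\mathcal{A}$ for $T$ rounds, then for every player $i$ $$\mathrm{Reg}_{i,T}\le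 K\, m\,\log n_i\,\log^4T .$$ 2. For every $n\ge1$ and every sequence $\ell^1,\dots,\ell^T\in[0,1]^n$, the regret of $\mathcal{A}$ on this sequence satisfies $$\mathrm{Reg}_T\le K\left(m\,\log n\,\log^4T+\sqrt{T\log n}\right).$$ -/

import Mathlib

namespace LearningInGames

open Finset

/-- A (deterministic, full-information) online learning algorithm with `n` actions: it maps the
list of the loss vectors observed so far (oldest first) to the strategy, a vector in `ℝⁿ`, used in
the next round. -/
abbrev OnlineAlgorithm (n : ℕ) : Type := List (Fin n → ℝ) → Fin n → ℝ

/-- The loss vector of round `t` in a history; rounds are numbered from `1`, and `ℓ⁰ = 0`. -/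
def lossAt {n : ℕ} (h : List (Fin n → ℝ)) : ℕ → Fin n → ℝ
  | 0 => 0
  | t + 1 => h.getD t 0

/-- `Var_P(v) = ∑ⱼ P(j) (v(j) - ∑ₖ P(k) v(k))²`. -/
noncomputable def variance {n : ℕ} (P v : Fin n → ℝ) : ℝ :=
  ∑ j, P j * (v j - ∑ k, P k * v k) ^ 2

/-- The iterates `x¹, x², …` of Optimistic Hedge with step size `η` on the losses `ℓ⁰, ℓ¹, ℓ², …`:
`x¹` is uniform and `xᵗ⁺¹(j) ∝ xᵗ(j) exp(-η (2 ℓᵗ(j) - ℓᵗ⁻¹(j)))`. The value at index `0` is a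
placeholder. -/
noncomputable def optHedgeIter {n : ℕ} (η : ℝ) (l : ℕ → Fin n → ℝ) : ℕ → Fin n → ℝ
  | 0 => fun _ => 1 / n
  | 1 => fun _ => 1 / n
  | t + 2 => fun j =>
      optHedgeIter η l (t + 1) j * Real.exp (-η * (2 * l (t + 1) j - l t j)) /
        ∑ k, optHedgeIter η l (t + 1) k * Real.exp (-η * (2 * l (t + 1) k - l t k))

/-- Optimistic Hedge with step size `η`, as an online algorithm. -/
noncomputable def optHedge {n : ℕ} (η : ℝ) : OnlineAlgorithm n :=
  fun h => optHedgeIter η (lossAt h) (h.length + 1)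

/-- The switching test at time `T₀` (with `T` the horizon): `T₀ ≥ 4`, and the variation of the
losses along the Optimistic Hedge iterates with step size `η` satisfies
`∑_{t ≤ T₀} Var_{xᵗ}(ℓᵗ - ℓᵗ⁻¹) > (1/2) ∑_{t ≤ T₀} Var_{xᵗ}(ℓᵗ⁻¹) + C' ⌈log₂ T⌉⁵`. -/
def SwitchTest {n : ℕ} (C' η : ℝ) (T : ℕ) (l : ℕ → Fin n → ℝ) (T₀ : ℕ) : Prop :=
  4 ≤ T₀ ∧
    (1 / 2) * ∑ t ∈ Icc 1 T₀, variance (optHedgeIter η l t) (l (t - 1))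
        + C' * (⌈Real.logb 2 T⌉₊ : ℝ) ^ 5
      < ∑ t ∈ Icc 1 T₀, variance (optHedgeIter η l t) (l t - l (t - 1))

open Classical in
/-- Optimistic Hedge with a one-time switch of the step size, for `m` players and horizon `T`: run
Optimistic Hedge with step size `1 / (C m log₂⁴ T)` up to and including the first round `T₀` at
which the switching test succeeds; from round `T₀ + 1` on, run Optimistic Hedge afresh (on the
losses after `T₀`) with step size `√(log₂ n / T)`. -/
noncomputable def switchedOptHedge (C C' : ℝ) (m T n : ℕ) : OnlineAlgorithm n :=
  fun h =>
    let η : ℝ := 1 / (C * m * Real.logb 2 T ^ 4)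
    let η' : ℝ := Real.sqrt (Real.logb 2 n / T)
    if hs : ∃ T₀, T₀ ≤ h.length ∧ SwitchTest C' η T (lossAt h) T₀ then
      optHedge η' (h.drop (Nat.find hs))
    else
      optHedge η h

/-- The regret `∑_{t ≤ T} ⟨xᵗ, ℓᵗ⟩ - min_j ∑_{t ≤ T} ℓᵗ(j)` (rounds numbered from `1`). -/
noncomputable def regret {n : ℕ} (x l : ℕ → Fin n → ℝ) (T : ℕ) : ℝ :=
  ∑ t ∈ Icc 1 T, ∑ j, x t j * l t j - ⨅ j, ∑ t ∈ Icc 1 T, l t j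

/-- The strategy used in round `t ≥ 1` by an algorithm facing the losses `ℓ¹, ℓ², …`: the algorithm
sees `ℓ¹, …, ℓᵗ⁻¹`. -/
def strategyAgainst {n : ℕ} (A : OnlineAlgorithm n) (l : ℕ → Fin n → ℝ) (t : ℕ) : Fin n → ℝ :=
  A ((List.range (t - 1)).map fun s => l (s + 1))

/-- A game with `m` players, player `i` having `n i` actions, and losses in `[0,1]`. -/
structure Game (m : ℕ) (n : Fin m → ℕ) where
  /-- The loss of each player at an action profile. -/
  loss : Fin m → (∀ k, Fin (n k)) → ℝ
  /-- Losses lie in `[0,1]`. -/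
  loss_mem : ∀ i a, loss i a ∈ Set.Icc (0 : ℝ) 1

/-- The loss vector of player `i` under the mixed strategy profile `x`: its `j`-th entry is the
expectation of `loss i (j, a₋ᵢ)` for `a₋ᵢ` drawn from the product of the `x k`, `k ≠ i`. -/
def Game.lossVector {m : ℕ} {n : Fin m → ℕ} (G : Game m n) (x : ∀ k, Fin (n k) → ℝ)
    (i : Fin m) (j : Fin (n i)) : ℝ :=
  ∑ a : ∀ k, Fin (n k), if a i = j then (∏ k ∈ univ.erase i, x k (a k)) * G.loss i a else 0

/-- The loss vectors observed by each player during the first `t` rounds of repeated play of `G`,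
when every player `k` uses the algorithm `A k`. -/
def Game.history {m : ℕ} {n : Fin m → ℕ} (G : Game m n) (A : ∀ k, OnlineAlgorithm (n k)) :
    ℕ → ∀ k, List (Fin (n k) → ℝ)
  | 0 => fun _ => []
  | t + 1 => fun i => G.history A t i ++ [G.lossVector (fun k => A k (G.history A t k)) i]

/-- The strategy of each player in round `t ≥ 1` of repeated play of `G`. -/
def Game.strategy {m : ℕ} {n : Fin m → ℕ} (G : Game m n) (A : ∀ k, OnlineAlgorithm (n k))
    (t : ℕ) (k : Fin m) : Fin (n k) → ℝ :=
  A k (G.history A (t - 1) k)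

/-- The regret of player `i` after `T` rounds of repeated play of `G`. -/
noncomputable def Game.playerRegret {m : ℕ} {n : Fin m → ℕ} (G : Game m n)
    (A : ∀ k, OnlineAlgorithm (n k)) (T : ℕ) (i : Fin m) : ℝ :=
  regret (fun t => G.strategy A t i) (fun t => G.lossVector (G.strategy A t) i) T

/-- The iterates of Optimistic Hedge are mixed strategies with full support. -/
theorem optHedgeIter_pos_and_sum {n : ℕ} (hn : 0 < n) (η : ℝ) (l : ℕ → Fin n → ℝ) :
    ∀ t, (∀ j, 0 < optHedgeIter η l t j) ∧ ∑ j, optHedgeIter η l t j = 1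
  | 0 => by
      have h : (0 : ℝ) < n := by exact_mod_cast hn
      refine ⟨fun j => by simp only [optHedgeIter]; positivity, ?_⟩
      simp [optHedgeIter, h.ne']
  | 1 => by
      have h : (0 : ℝ) < n := by exact_mod_cast hn
      refine ⟨fun j => by simp only [optHedgeIter]; positivity, ?_⟩
      simp [optHedgeIter, h.ne']
  | t + 2 => by
      obtain ⟨hp, -⟩ := optHedgeIter_pos_and_sum hn η l (t + 1)
      have : Nonempty (Fin n) := ⟨⟨0, hn⟩⟩
      have hS : 0 < ∑ k, optHedgeIter η l (t + 1) k *
          Real.exp (-η * (2 * l (t + 1) k - l t k)) :=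
        Finset.sum_pos (fun k _ => mul_pos (hp k) (Real.exp_pos _)) univ_nonempty
      refine ⟨fun j => ?_, ?_⟩
      · simp only [optHedgeIter]
        exact div_pos (mul_pos (hp j) (Real.exp_pos _)) hS
      · simp only [optHedgeIter]
        rw [← Finset.sum_div, div_self hS.ne']

/-- The algorithm always plays a mixed strategy. -/
theorem switchedOptHedge_mem_stdSimplex {n : ℕ} (hn : 0 < n) (C C' : ℝ) (m T : ℕ)
    (h : List (Fin n → ℝ)) : switchedOptHedge C C' m T n h ∈ stdSimplex ℝ (Fin n) := by
  have key : ∀ (η : ℝ) (h : List (Fin n → ℝ)), optHedge η h ∈ stdSimplex ℝ (Fin n) := by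
    intro η h
    have := optHedgeIter_pos_and_sum hn η (lossAt h) (h.length + 1)
    exact ⟨fun j => (this.1 j).le, this.2⟩
  unfold switchedOptHedge
  dsimp only
  split_ifs
  · exact key _ _
  · exact key _ _

end LearningInGames

namespace LearningInGames

open Finset

/-! ### Iterated forward differences -/

/-! Up to constants and a factor `η`, Optimistic Hedge pays `∑ Var(ℓᵗ - ℓᵗ⁻¹)` and earns back `∑
Var(ℓᵗ⁻¹)` (`mul_regret_le_sum_centeredCgf`, with second-order estimates of the two cumulant
generating functions). If the first sum is at most half the second plus `B`, the regret is at most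
`log n / η + η B` (`regret_le_of_variation_le`). The switching test monitors exactly this
inequality. Against arbitrary losses the phase before the switch therefore enjoys that bound, and
the phase after it the usual `√T` bound (`regret_le_sqrt`).

It remains to see that the test never succeeds in self-play. The log-weights of a strategy are `η`
times sums of past losses, and losses are multilinear in the strategies, so differences of order `h`
of the losses are governed by those of lower order. An induction in a submultiplicative norm
(`windowNorm`) bounds them by `3 δ ^ h` with `δ = 72 η m H²`, for all `h ≤ H = ⌈log₂ T⌉`
(`Game.IsOptHedgePlay.abs_fwdDiff_iter_le`).

Let `a h` be the summed variances of the `h`-th differences. Summation by parts and Cauchy–Schwarz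
make `a` approximately log-convex (`sum_variance_fwdDiff_le`), so its successive ratios hardly
decrease. Were `a 1 > a 0 / 2 + 540 H`, then `a H` would be at least of order `(9/25) ^ H`; but
smoothness gives `a H ≤ 2 ^ H * (3 δ ^ H) ^ 2`, which is smaller (`sum_variance_fwdDiff_le_half`).
Hence play coincides with plain Optimistic Hedge. -/

theorem fwdDiff_iter_succ_apply (h : ℕ) (u : ℕ → ℝ) (s : ℕ) :
    (fwdDiff 1)^[h + 1] u s = (fwdDiff 1)^[h] u (s + 1) - (fwdDiff 1)^[h] u s := by
  rw [Function.iterate_succ_apply']; rfl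

/-- The Leibniz rule for iterated forward differences. -/
theorem fwdDiff_iter_mul (u v : ℕ → ℝ) (h s : ℕ) :
    (fwdDiff 1)^[h] (fun t => u t * v t) s =
      ∑ p ∈ antidiagonal h, (h.choose p.1 : ℝ) *
        ((fwdDiff 1)^[p.1] u s * (fwdDiff 1)^[p.2] v (s + p.1)) := by
  induction h generalizing s with
  | zero => simp
  | succ n ih =>
    rw [sum_antidiagonal_choose_succ_mul
      (fun i r => (fwdDiff 1)^[i] u s * (fwdDiff 1)^[r] v (s + i)), fwdDiff_iter_succ_apply,
      ih, ih, ← sum_sub_distrib, ← sum_add_distrib]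
    refine sum_congr rfl fun p hp => ?_
    have hc : n.choose p.2 = n.choose p.1 := by
      rw [← mem_antidiagonal.1 hp, Nat.choose_symm_add]
    rw [hc, fwdDiff_iter_succ_apply, fwdDiff_iter_succ_apply,
      show s + 1 + p.1 = s + p.1 + 1 by ring, show s + (p.1 + 1) = s + p.1 + 1 by ring]
    ring

/-! ### A submultiplicative norm measuring smoothness on a finite window -/

/-- The largest `h`-th forward difference of `u` within the window `0, …, K`. -/
noncomputable def windowSup (K h : ℕ) (u : ℕ → ℝ) : ℝ :=
  (range (K - h + 1)).sup' nonempty_range_add_one fun s => |(fwdDiff 1)^[h] u s|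

/-- A submultiplicative norm on the functions on the window `0, …, K`: the sum of the forward
differences of all orders, with exponential weights. -/
noncomputable def windowNorm (K : ℕ) (ρ : ℝ) (u : ℕ → ℝ) : ℝ :=
  ∑ h ∈ range (K + 1), ρ ^ h / h.factorial * windowSup K h u

section WindowNorm

variable {K : ℕ} {ρ : ℝ}

theorem le_windowSup {h s : ℕ} (u : ℕ → ℝ) (hs : s ≤ K - h) :
    |(fwdDiff 1)^[h] u s| ≤ windowSup K h u :=
  le_sup' (fun s => |(fwdDiff 1)^[h] u s|) (mem_range.2 (by omega))

theorem windowSup_le {h : ℕ} {u : ℕ → ℝ} {a : ℝ}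
    (H : ∀ s ≤ K - h, |(fwdDiff 1)^[h] u s| ≤ a) : windowSup K h u ≤ a :=
  sup'_le _ _ fun s hs => H s (by have := mem_range.1 hs; omega)

theorem windowSup_nonneg (h : ℕ) (u : ℕ → ℝ) : 0 ≤ windowSup K h u :=
  (abs_nonneg _).trans (le_windowSup u (Nat.zero_le _))

theorem windowNorm_nonneg (hρ : 0 ≤ ρ) (u : ℕ → ℝ) : 0 ≤ windowNorm K ρ u :=
  sum_nonneg fun h _ => mul_nonneg (by positivity) (windowSup_nonneg h u)

theorem windowNorm_le_of_windowSup {a b : ℝ} {u : ℕ → ℝ}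
    (h0 : windowSup K 0 u ≤ a)
    (h1 : ∀ h < K, ρ ^ (h + 1) / (h + 1).factorial * windowSup K (h + 1) u ≤ b) :
    windowNorm K ρ u ≤ a + K * b := by
  rw [windowNorm, sum_range_succ']
  have := sum_le_sum fun h hh => h1 h (mem_range.1 hh)
  rw [sum_const, card_range, nsmul_eq_mul] at this
  simp only [pow_zero, Nat.factorial_zero, Nat.cast_one, div_one, one_mul]
  linarith

theorem abs_fwdDiff_iter_le_windowNorm (hρ : 0 < ρ) (u : ℕ → ℝ) :
    |(fwdDiff 1)^[K] u 0| ≤ K.factorial / ρ ^ K * windowNorm K ρ u := by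
  have h1 : ρ ^ K / K.factorial * windowSup K K u ≤ windowNorm K ρ u :=
    single_le_sum (f := fun h => ρ ^ h / h.factorial * windowSup K h u)
      (fun h _ => mul_nonneg (by positivity) (windowSup_nonneg h u)) (self_mem_range_succ K)
  have h2 := le_windowSup (K := K) (h := K) u (s := 0) (Nat.zero_le _)
  have h3 : (K.factorial : ℝ) / ρ ^ K * (ρ ^ K / K.factorial * windowSup K K u)
      = windowSup K K u := by
    have : (K.factorial : ℝ) ≠ 0 := by positivity
    field_simp
  calc _ ≤ _ := h2
    _ = _ := h3.symm
    _ ≤ _ := by gcongr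

theorem windowNorm_le_sum {ι : Type*} (hρ : 0 ≤ ρ) (S : Finset ι) (u : ι → ℕ → ℝ) :
    windowNorm K ρ (fun s => ∑ i ∈ S, u i s) ≤ ∑ i ∈ S, windowNorm K ρ (u i) := by
  simp only [windowNorm]
  rw [sum_comm]
  refine sum_le_sum fun h _ => ?_
  rw [← mul_sum]
  refine mul_le_mul_of_nonneg_left (windowSup_le fun s hs => ?_) (by positivity)
  rw [← sum_fn, fwdDiff_iter_finsetSum, Finset.sum_apply]
  exact (abs_sum_le_sum_abs _ _).trans (sum_le_sum fun i _ => le_windowSup _ hs)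

theorem windowNorm_add_le (hρ : 0 ≤ ρ) (u v : ℕ → ℝ) :
    windowNorm K ρ (fun s => u s + v s) ≤ windowNorm K ρ u + windowNorm K ρ v := by
  have := windowNorm_le_sum (K := K) hρ univ (fun b : Bool => if b then u else v)
  simpa using this

theorem windowNorm_const_mul (c : ℝ) (u : ℕ → ℝ) :
    windowNorm K ρ (fun s => c * u s) = |c| * windowNorm K ρ u := by
  rw [windowNorm, windowNorm, mul_sum]
  refine sum_congr rfl fun h _ => ?_
  have : windowSup K h (fun s => c * u s) = |c| * windowSup K h u := by
    rw [windowSup, windowSup, mul₀_sup' (abs_nonneg c)]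
    refine sup'_congr _ rfl fun s _ => ?_
    have := congrFun (fwdDiff_iter_const_smul (h := 1) c u h) s
    rw [← abs_mul]
    exact congrArg _ this
  rw [this]
  ring

theorem windowNorm_one : windowNorm K ρ (fun _ => 1) = 1 := by
  have h1 : ∀ h, (fwdDiff 1)^[h + 1] (fun _ : ℕ => (1 : ℝ)) = fun _ => 0 := by
    intro h
    induction h with
    | zero => simp
    | succ h ih => rw [Function.iterate_succ_apply', ih]; simp
  rw [windowNorm, sum_range_succ']
  simp [windowSup, h1]

/-- The weights `1 / h!` absorb the binomials of the Leibniz rule, turning the norm of a product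
into a Cauchy product truncated at total order `K`; the missing terms are nonnegative. The shift by
`p.1` in the Leibniz rule stays in the window because the range of base points shrinks as the order
grows. -/
theorem windowNorm_mul_le (hρ : 0 ≤ ρ) (u v : ℕ → ℝ) :
    windowNorm K ρ (fun s => u s * v s) ≤ windowNorm K ρ u * windowNorm K ρ v := by
  set a : ℕ → ℝ := fun h => ρ ^ h / h.factorial * windowSup K h u with ha
  set b : ℕ → ℝ := fun h => ρ ^ h / h.factorial * windowSup K h v with hb
  have hsup : ∀ h ≤ K, ρ ^ h / h.factorial * windowSup K h (fun s => u s * v s) ≤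
      ∑ p ∈ antidiagonal h, a p.1 * b p.2 := by
    intro h hh
    have h1 : windowSup K h (fun s => u s * v s) ≤ ∑ p ∈ antidiagonal h, (h.choose p.1 : ℝ) *
        (windowSup K p.1 u * windowSup K p.2 v) := by
      refine windowSup_le fun s hs => ?_
      rw [fwdDiff_iter_mul]
      refine (abs_sum_le_sum_abs _ _).trans (sum_le_sum fun p hp => ?_)
      have := mem_antidiagonal.1 hp
      rw [abs_mul, abs_mul, Nat.abs_cast]
      refine mul_le_mul_of_nonneg_left (mul_le_mul (le_windowSup u (by omega))
        (le_windowSup v (by omega)) (abs_nonneg _) (windowSup_nonneg _ _)) (by positivity)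
    refine (mul_le_mul_of_nonneg_left h1 (by positivity)).trans (le_of_eq ?_)
    rw [mul_sum]
    refine sum_congr rfl fun p hp => ?_
    have hp' := mem_antidiagonal.1 hp
    have hf : (h.factorial : ℝ) = h.choose p.1 * p.1.factorial * p.2.factorial := by
      rw [← hp']
      rw [Nat.choose_symm_add]
      exact_mod_cast (Nat.add_choose_mul_factorial_mul_factorial p.1 p.2).symm
    have hc : (h.choose p.1 : ℝ) ≠ 0 := by
      have : 0 < h.choose p.1 := Nat.choose_pos (by omega)
      positivity
    have f1 : (p.1.factorial : ℝ) ≠ 0 := by positivity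
    have f2 : (p.2.factorial : ℝ) ≠ 0 := by positivity
    have hpow : ρ ^ h = ρ ^ p.1 * ρ ^ p.2 := by rw [← pow_add, hp']
    simp only [ha, hb]
    rw [hf, hpow]
    field_simp
  have hab : ∀ h, 0 ≤ a h ∧ 0 ≤ b h := fun h =>
    ⟨mul_nonneg (by positivity) (windowSup_nonneg _ _),
      mul_nonneg (by positivity) (windowSup_nonneg _ _)⟩
  calc windowNorm K ρ (fun s => u s * v s)
      ≤ ∑ h ∈ range (K + 1), ∑ p ∈ antidiagonal h, a p.1 * b p.2 :=
        sum_le_sum fun h hh => hsup h (by have := mem_range.1 hh; omega)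
    _ = ∑ x ∈ (range (K + 1)).sigma (fun h => antidiagonal h), a x.2.1 * b x.2.2 := by
        rw [sum_sigma]
    _ ≤ ∑ p ∈ range (K + 1) ×ˢ range (K + 1), a p.1 * b p.2 := by
        have hinj : Set.InjOn (fun x : (_ : ℕ) × (ℕ × ℕ) => x.2)
            ((range (K + 1)).sigma (fun h => antidiagonal h) : Set _) := by
          rintro ⟨h, p⟩ hx ⟨h', p'⟩ hx' (rfl : p = p')
          simp only [coe_sigma, Set.mem_sigma_iff, mem_coe, HasAntidiagonal.mem_antidiagonal] at hx hx'
          obtain rfl : h = h' := hx.2.symm.trans hx'.2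
          rfl
        rw [← sum_image (f := fun p : ℕ × ℕ => a p.1 * b p.2) hinj]
        refine sum_le_sum_of_subset_of_nonneg ?_ fun p _ _ => mul_nonneg (hab _).1 (hab _).2
        rintro p hp
        simp only [mem_image, mem_sigma, mem_range, HasAntidiagonal.mem_antidiagonal] at hp
        obtain ⟨x, hx, rfl⟩ := hp
        simp only [mem_product, mem_range]
        omega
    _ = windowNorm K ρ u * windowNorm K ρ v := by
        rw [windowNorm, windowNorm, sum_mul_sum, sum_product]

theorem windowNorm_prod_le {ι : Type*} (hρ : 0 ≤ ρ) (S : Finset ι) (u : ι → ℕ → ℝ) :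
    windowNorm K ρ (fun s => ∏ i ∈ S, u i s) ≤ ∏ i ∈ S, windowNorm K ρ (u i) := by
  classical
  induction S using Finset.induction_on with
  | empty => simp [windowNorm_one]
  | insert i S hi ih =>
    simp only [prod_insert hi]
    exact (windowNorm_mul_le hρ _ _).trans
      (mul_le_mul_of_nonneg_left ih (windowNorm_nonneg hρ _))

theorem windowNorm_pow_le (hρ : 0 ≤ ρ) (u : ℕ → ℝ) (k : ℕ) :
    windowNorm K ρ (fun s => u s ^ k) ≤ windowNorm K ρ u ^ k := by
  simpa using windowNorm_prod_le (K := K) hρ (range k) fun _ => u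

/-- Only finitely many values enter the norm, so pointwise convergence suffices. -/
theorem tendsto_windowNorm {f : ℕ → ℕ → ℝ} {u : ℕ → ℝ}
    (hf : ∀ s, Filter.Tendsto (fun n => f n s) Filter.atTop (nhds (u s))) :
    Filter.Tendsto (fun n => windowNorm K ρ (f n)) Filter.atTop (nhds (windowNorm K ρ u)) := by
  have hd : ∀ h s, Filter.Tendsto (fun n => (fwdDiff 1)^[h] (f n) s) Filter.atTop
      (nhds ((fwdDiff 1)^[h] u s)) := by
    intro h
    induction h with
    | zero => exact hf
    | succ h ih =>
      intro s
      simp only [fwdDiff_iter_succ_apply]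
      exact (ih _).sub (ih _)
  refine tendsto_finsetSum _ fun h _ => Filter.Tendsto.const_mul _ ?_
  exact Filter.Tendsto.finset_sup'_nhds_apply _ fun s _ => (hd h s).abs

/-- Submultiplicativity bounds each term of the exponential series by the same term at the norm;
then pass to the limit. -/
theorem windowNorm_exp_sub_one_le (hρ : 0 ≤ ρ) (u : ℕ → ℝ) :
    windowNorm K ρ (fun s => Real.exp (u s) - 1) ≤ Real.exp (windowNorm K ρ u) - 1 := by
  have hseries : ∀ x : ℝ, Filter.Tendsto
      (fun n => ∑ k ∈ range n, ((k + 1).factorial : ℝ)⁻¹ * x ^ (k + 1)) Filter.atTop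
      (nhds (Real.exp x - 1)) := by
    intro x
    have h := (NormedSpace.expSeries_div_hasSum_exp (𝔸 := ℝ) x)
    rw [← Real.exp_eq_exp_ℝ] at h
    have := (h.tendsto_sum_nat.comp (Filter.tendsto_add_atTop_nat 1)).sub_const 1
    refine this.congr fun n => ?_
    simp only [Function.comp_apply]
    rw [sum_range_succ']
    simp [div_eq_inv_mul]
  have h1 := tendsto_windowNorm (K := K) (ρ := ρ) fun s => hseries (u s)
  refine le_of_tendsto_of_tendsto' h1 (hseries (windowNorm K ρ u)) fun n => ?_
  refine (windowNorm_le_sum hρ _ _).trans (sum_le_sum fun k _ => ?_)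
  rw [windowNorm_const_mul, abs_of_nonneg (by positivity)]
  exact mul_le_mul_of_nonneg_left (windowNorm_pow_le hρ u _) (by positivity)

/-- From `1/g = 1 - (g - 1)/g` the norm `x` of the inverse satisfies `x ≤ 1 + q x`. As `x` is a
finite number, this can be solved for `x` without a Neumann series. -/
theorem windowNorm_inv_le (hρ : 0 ≤ ρ) {g : ℕ → ℝ} (hg : ∀ s, g s ≠ 0) {q : ℝ} (hq : q < 1)
    (h : windowNorm K ρ (fun s => g s - 1) ≤ q) :
    windowNorm K ρ (fun s => (g s)⁻¹) ≤ 1 / (1 - q) := by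
  have h1 : (fun s => (g s)⁻¹) = fun s => 1 + (-1) * ((g s - 1) * (g s)⁻¹) := by
    funext s
    field_simp [hg s]
    ring
  have h2 : windowNorm K ρ (fun s => (g s)⁻¹) ≤ 1 + q * windowNorm K ρ (fun s => (g s)⁻¹) := by
    conv_lhs => rw [h1]
    refine (windowNorm_add_le hρ _ _).trans ?_
    rw [windowNorm_one, windowNorm_const_mul, abs_neg, abs_one, one_mul]
    gcongr
    exact (windowNorm_mul_le hρ _ _).trans
      (mul_le_mul_of_nonneg_right h (windowNorm_nonneg hρ _))
  rw [le_div_iff₀ (by linarith)]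
  linarith

/-- A softmax of slowly varying weights has window norm close to `1`, summed over the actions. -/
theorem sum_windowNorm_softmax_le {ι : Type*} [Fintype ι] (hρ : 0 ≤ ρ) {p : ι → ℝ}
    (hp : ∀ j, 0 < p j) (hp1 : ∑ j, p j = 1) {w : ι → ℕ → ℝ} {q : ℝ} (hq0 : 0 ≤ q)
    (hq : q ≤ 1 / 4) (hw : ∀ j, windowNorm K ρ (w j) ≤ q) :
    ∑ j, windowNorm K ρ (fun s => p j * Real.exp (w j s) / ∑ k, p k * Real.exp (w k s))
      ≤ 1 + 4 * q := by
  have hexp : ∀ j, windowNorm K ρ (fun s => Real.exp (w j s) - 1) ≤ Real.exp q - 1 := fun j =>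
    (windowNorm_exp_sub_one_le hρ _).trans (sub_le_sub_right (Real.exp_le_exp.2 (hw j)) _)
  have hne : Nonempty ι := by
    by_contra h
    rw [not_nonempty_iff] at h
    simp at hp1
  have hpos : ∀ s, 0 < ∑ k, p k * Real.exp (w k s) := fun s =>
    sum_pos (fun k _ => mul_pos (hp k) (Real.exp_pos _)) univ_nonempty
  have heq : Real.exp q ≤ 1 + q + q ^ 2 := by
    have := (abs_le.1 (Real.abs_exp_sub_one_sub_id_le (x := q)
      (by rw [abs_of_nonneg hq0]; linarith))).2
    linarith
  have hden : windowNorm K ρ (fun s => (∑ k, p k * Real.exp (w k s)) - 1) ≤ Real.exp q - 1 := by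
    -- Since `p` sums to `1`, the normalizer minus `1` is a `p`-average of the `exp (w k) - 1`.
    have : (fun s => (∑ k, p k * Real.exp (w k s)) - 1)
        = fun s => ∑ k, p k * (Real.exp (w k s) - 1) := by
      funext s
      simp only [mul_sub, sum_sub_distrib, mul_one, hp1]
    rw [this]
    refine (windowNorm_le_sum hρ _ _).trans ?_
    calc _ ≤ ∑ k, p k * (Real.exp q - 1) := by
          refine sum_le_sum fun k _ => ?_
          rw [windowNorm_const_mul, abs_of_pos (hp k)]
          exact mul_le_mul_of_nonneg_left (hexp k) (hp k).le
      _ = _ := by rw [← sum_mul, hp1, one_mul]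
  have hlt : Real.exp q - 1 < 1 := by nlinarith
  have hinv := windowNorm_inv_le hρ (fun s => (hpos s).ne') hlt hden
  have hnum : ∀ j, windowNorm K ρ (fun s => Real.exp (w j s)) ≤ Real.exp q := by
    intro j
    have := windowNorm_add_le (K := K) hρ (fun _ => 1) (fun s => Real.exp (w j s) - 1)
    rw [windowNorm_one] at this
    simp only [add_sub_cancel] at this
    linarith [hexp j]
  have hterm : ∀ j, windowNorm K ρ
      (fun s => p j * Real.exp (w j s) / ∑ k, p k * Real.exp (w k s)) ≤
      p j * (Real.exp q * (1 / (1 - (Real.exp q - 1)))) := by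
    intro j
    simp only [div_eq_mul_inv, mul_assoc]
    rw [windowNorm_const_mul, abs_of_pos (hp j)]
    refine mul_le_mul_of_nonneg_left ((windowNorm_mul_le hρ _ _).trans ?_) (hp j).le
    simp only [one_div, one_mul] at hinv ⊢
    exact mul_le_mul (hnum j) hinv (windowNorm_nonneg hρ _) (Real.exp_pos _).le
  calc _ ≤ ∑ j, p j * (Real.exp q * (1 / (1 - (Real.exp q - 1)))) :=
        sum_le_sum fun j _ => hterm j
    _ = Real.exp q * (1 / (1 - (Real.exp q - 1))) := by rw [← sum_mul, hp1, one_mul]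
    _ ≤ 1 + 4 * q := by
        -- With `exp q ≤ 1 + q + q²`, the claim `exp q ≤ (1 + 4q)(2 - exp q)` reduces to `3q + 2q² ≤
        -- 1`, true for `q ≤ 1/4`.
        rw [mul_one_div, div_le_iff₀ (by linarith)]
        nlinarith [mul_nonneg hq0 hq0, mul_nonneg hq0 (sub_nonneg.2 hq),
          mul_nonneg (mul_nonneg hq0 hq0) (sub_nonneg.2 hq)]

end WindowNorm

/-! ### Variances of difference sequences along slowly varying distributions -/

section Covariance

variable {n : ℕ}

/-- The covariance of `u` and `w` under `P`, in its symmetrized form. -/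
noncomputable def covariance (P u w : Fin n → ℝ) : ℝ :=
  (1 / 2) * ∑ x : Fin n × Fin n, P x.1 * P x.2 * ((u x.1 - u x.2) * (w x.1 - w x.2))

theorem variance_eq {P : Fin n → ℝ} (h1 : ∑ j, P j = 1) (v : Fin n → ℝ) :
    variance P v = ∑ j, P j * v j ^ 2 - (∑ j, P j * v j) ^ 2 := by
  rw [variance]
  have : ∀ j, P j * (v j - ∑ k, P k * v k) ^ 2 =
      P j * v j ^ 2 - 2 * (∑ k, P k * v k) * (P j * v j) + (∑ k, P k * v k) ^ 2 * P j :=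
    fun j => by ring
  simp only [this, sum_add_distrib, sum_sub_distrib, ← mul_sum, h1]
  ring

theorem variance_eq_covariance {P : Fin n → ℝ} (h1 : ∑ j, P j = 1) (v : Fin n → ℝ) :
    variance P v = covariance P v v := by
  rw [variance_eq h1, covariance, Fintype.sum_prod_type]
  have : ∀ i j, P i * P j * ((v i - v j) * (v i - v j)) =
      P i * v i ^ 2 * P j - 2 * (P i * v i) * (P j * v j) + P i * (P j * v j ^ 2) :=
    fun i j => by ring
  simp only [this, sum_add_distrib, sum_sub_distrib, ← mul_sum, ← sum_mul, h1]
  ring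

theorem variance_nonneg {P : Fin n → ℝ} (h0 : ∀ j, 0 ≤ P j) (v : Fin n → ℝ) :
    0 ≤ variance P v :=
  sum_nonneg fun j _ => mul_nonneg (h0 j) (sq_nonneg _)

theorem variance_le_sq {P : Fin n → ℝ} (h0 : ∀ j, 0 ≤ P j) (h1 : ∑ j, P j = 1) {v : Fin n → ℝ}
    {a : ℝ} (hv : ∀ j, |v j| ≤ a) : variance P v ≤ a ^ 2 := by
  rw [variance_eq h1]
  have : ∑ j, P j * v j ^ 2 ≤ ∑ j, P j * a ^ 2 := by
    refine sum_le_sum fun j _ => mul_le_mul_of_nonneg_left ?_ (h0 j)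
    rw [← sq_abs]
    exact pow_le_pow_left₀ (abs_nonneg _) (hv j) 2
  rw [← sum_mul, h1, one_mul] at this
  linarith [sq_nonneg (∑ j, P j * v j)]

theorem covariance_sub_left (P u u' w : Fin n → ℝ) :
    covariance P (u - u') w = covariance P u w - covariance P u' w := by
  simp only [covariance, ← mul_sub, ← sum_sub_distrib, Pi.sub_apply]
  exact congrArg _ (sum_congr rfl fun x _ => by ring)

theorem covariance_sub_right (P u w w' : Fin n → ℝ) :
    covariance P u (w - w') = covariance P u w - covariance P u w' := by
  simp only [covariance, ← mul_sub, ← sum_sub_distrib, Pi.sub_apply]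
  exact congrArg _ (sum_congr rfl fun x _ => by ring)

/-- The Cauchy–Schwarz inequality for covariances, with absolute values inside the sum. -/
theorem sum_abs_mul_abs_le {P : Fin n → ℝ} (h0 : ∀ j, 0 ≤ P j) (h1 : ∑ j, P j = 1)
    (u w : Fin n → ℝ) :
    (1 / 2) * ∑ x : Fin n × Fin n, P x.1 * P x.2 * (|u x.1 - u x.2| * |w x.1 - w x.2|) ≤
      √(variance P u) * √(variance P w) := by
  have key := Real.sum_sqrt_mul_sqrt_le (univ : Finset (Fin n × Fin n))
    (f := fun x => P x.1 * P x.2 * ((u x.1 - u x.2) * (u x.1 - u x.2)))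
    (g := fun x => P x.1 * P x.2 * ((w x.1 - w x.2) * (w x.1 - w x.2)))
    (fun x => mul_nonneg (mul_nonneg (h0 _) (h0 _)) (mul_self_nonneg _))
    (fun x => mul_nonneg (mul_nonneg (h0 _) (h0 _)) (mul_self_nonneg _))
  rw [variance_eq_covariance h1, variance_eq_covariance h1, covariance, covariance,
    Real.sqrt_mul (by norm_num), Real.sqrt_mul (by norm_num)]
  have h2 : √(1 / 2 : ℝ) * √(1 / 2 : ℝ) = 1 / 2 := Real.mul_self_sqrt (by norm_num)
  rw [mul_mul_mul_comm, h2]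
  refine mul_le_mul_of_nonneg_left (le_trans (le_of_eq ?_) key) (by norm_num)
  refine sum_congr rfl fun x _ => ?_
  have hP := mul_nonneg (h0 x.1) (h0 x.2)
  rw [Real.sqrt_mul hP, Real.sqrt_mul hP, Real.sqrt_mul_self_eq_abs, Real.sqrt_mul_self_eq_abs,
    mul_mul_mul_comm √_, Real.mul_self_sqrt hP]

theorem abs_covariance_le {P : Fin n → ℝ} (h0 : ∀ j, 0 ≤ P j) (h1 : ∑ j, P j = 1)
    (u w : Fin n → ℝ) : |covariance P u w| ≤ √(variance P u) * √(variance P w) := by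
  refine le_trans ?_ (sum_abs_mul_abs_le h0 h1 u w)
  rw [covariance, abs_mul, abs_of_pos (by norm_num : (0 : ℝ) < 1 / 2)]
  refine mul_le_mul_of_nonneg_left ((abs_sum_le_sum_abs _ _).trans (le_of_eq ?_)) (by norm_num)
  refine sum_congr rfl fun x _ => ?_
  rw [abs_mul, abs_mul (u x.1 - u x.2), abs_of_nonneg (mul_nonneg (h0 _) (h0 _))]

theorem abs_covariance_le_mul {P : Fin n → ℝ} (h0 : ∀ j, 0 ≤ P j) (h1 : ∑ j, P j = 1)
    {u w : Fin n → ℝ} {a b : ℝ} (ha : 0 ≤ a) (hb : 0 ≤ b) (hu : ∀ j, |u j| ≤ a)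
    (hw : ∀ j, |w j| ≤ b) : |covariance P u w| ≤ a * b := by
  refine (abs_covariance_le h0 h1 u w).trans (mul_le_mul ?_ ?_ (Real.sqrt_nonneg _) ha)
  · exact Real.sqrt_le_iff.2 ⟨ha, variance_le_sq h0 h1 hu⟩
  · exact Real.sqrt_le_iff.2 ⟨hb, variance_le_sq h0 h1 hw⟩

/-- Two vectors agree up to a factor `1 + ζ` in each coordinate. -/
def RatioClose (ζ : ℝ) (P Q : Fin n → ℝ) : Prop :=
  ∀ j, P j ≤ (1 + ζ) * Q j ∧ Q j ≤ (1 + ζ) * P j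

/-- No mean appears in the symmetrized form, so a change of measure only rescales the pair weights
`P x.1 * P x.2`. -/
theorem variance_le_of_ratioClose {ζ : ℝ} (hζ : 0 ≤ ζ) {P Q : Fin n → ℝ} (hP : ∀ j, 0 ≤ P j)
    (hP1 : ∑ j, P j = 1) (hQ : ∀ j, 0 ≤ Q j) (hQ1 : ∑ j, Q j = 1) (h : RatioClose ζ P Q)
    (v : Fin n → ℝ) : variance P v ≤ (1 + ζ) ^ 2 * variance Q v := by
  rw [variance_eq_covariance hP1, variance_eq_covariance hQ1, covariance, covariance,
    mul_left_comm _ (1 / 2 : ℝ), mul_sum _ _ ((1 + ζ) ^ 2)]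
  refine mul_le_mul_of_nonneg_left ?_ (by norm_num)
  refine sum_le_sum fun x _ => ?_
  rw [← mul_assoc ((1 + ζ) ^ 2)]
  refine mul_le_mul_of_nonneg_right ?_ (mul_self_nonneg _)
  calc P x.1 * P x.2 ≤ ((1 + ζ) * Q x.1) * ((1 + ζ) * Q x.2) :=
        mul_le_mul (h _).1 (h _).1 (hP _) (mul_nonneg (by linarith) (hQ _))
    _ = _ := by ring

/-- Pair weights change by a factor at most `(1 + ζ)² ≤ 1 + 3ζ`. The changes have no common sign,
hence the version of Cauchy–Schwarz with absolute values inside the sum. -/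
theorem abs_covariance_sub_le {ζ : ℝ} (hζ : 0 ≤ ζ) (hζ1 : ζ ≤ 1) {P Q : Fin n → ℝ}
    (hP : ∀ j, 0 ≤ P j) (hQ : ∀ j, 0 ≤ Q j) (hQ1 : ∑ j, Q j = 1) (h : RatioClose ζ P Q)
    (u w : Fin n → ℝ) :
    |covariance P u w - covariance Q u w| ≤ 3 * ζ * (√(variance Q u) * √(variance Q w)) := by
  refine le_trans ?_ (mul_le_mul_of_nonneg_left (sum_abs_mul_abs_le hQ hQ1 u w) (by linarith))
  rw [covariance, covariance, ← mul_sub, ← sum_sub_distrib, abs_mul,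
    abs_of_pos (by norm_num : (0 : ℝ) < 1 / 2), mul_left_comm _ (1 / 2 : ℝ), mul_sum _ _ (3 * ζ)]
  refine mul_le_mul_of_nonneg_left ?_ (by norm_num)
  refine (abs_sum_le_sum_abs _ _).trans (sum_le_sum fun x _ => ?_)
  rw [← sub_mul, abs_mul, abs_mul (u x.1 - u x.2), ← mul_assoc (3 * ζ)]
  refine mul_le_mul_of_nonneg_right ?_ (by positivity)
  have hq := mul_nonneg (hQ x.1) (hQ x.2)
  have hp := mul_nonneg (hP x.1) (hP x.2)
  have h1 : P x.1 * P x.2 ≤ (1 + ζ) ^ 2 * (Q x.1 * Q x.2) := by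
    calc P x.1 * P x.2 ≤ ((1 + ζ) * Q x.1) * ((1 + ζ) * Q x.2) :=
          mul_le_mul (h _).1 (h _).1 (hP _) (mul_nonneg (by linarith) (hQ _))
      _ = _ := by ring
  have h2 : Q x.1 * Q x.2 ≤ (1 + ζ) ^ 2 * (P x.1 * P x.2) := by
    calc Q x.1 * Q x.2 ≤ ((1 + ζ) * P x.1) * ((1 + ζ) * P x.2) :=
          mul_le_mul (h _).2 (h _).2 (hQ _) (mul_nonneg (by linarith) (hP _))
      _ = _ := by ring
  have h3 : (1 + ζ) ^ 2 ≤ 1 + 3 * ζ := by nlinarith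
  have h4 : Q x.1 * Q x.2 ≤ (1 + 3 * ζ) * (P x.1 * P x.2) :=
    h2.trans (mul_le_mul_of_nonneg_right h3 hp)
  have h5 : P x.1 * P x.2 ≤ (1 + 3 * ζ) * (Q x.1 * Q x.2) :=
    h1.trans (mul_le_mul_of_nonneg_right h3 hq)
  rw [abs_le]
  refine ⟨?_, by linarith⟩
  rcases le_total (P x.1 * P x.2) (Q x.1 * Q x.2) with hle | hle
  · nlinarith
  · have : 0 ≤ 3 * ζ * (Q x.1 * Q x.2) := by positivity
    linarith

end Covariance

/-! ### Summation by parts and approximate log-convexity -/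

section SummationByParts

variable {n : ℕ} {p v : ℕ → Fin n → ℝ} {ζ : ℝ}

/-- Summation by parts in `s`. Because the measure moves with `s`, a change-of-measure term appears
besides the boundary terms and the second difference. -/
theorem sum_covariance_fwdDiff (p v : ℕ → Fin n → ℝ) (M : ℕ) :
    ∑ s ∈ range (M + 1), covariance (p s) (fwdDiff 1 v s) (fwdDiff 1 v s) =
      covariance (p M) (v (M + 1)) (fwdDiff 1 v M) - covariance (p 0) (v 0) (fwdDiff 1 v 0) +
      ∑ s ∈ range M, ((covariance (p s) (v (s + 1)) (fwdDiff 1 v (s + 1)) -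
          covariance (p (s + 1)) (v (s + 1)) (fwdDiff 1 v (s + 1))) -
        covariance (p s) (v (s + 1)) (fwdDiff 1 (fwdDiff 1 v) s)) := by
  have h1 : ∀ s w, covariance (p s) (fwdDiff 1 v s) w =
      covariance (p s) (v (s + 1)) w - covariance (p s) (v s) w := fun s w => by
    rw [show fwdDiff 1 v s = v (s + 1) - v s from rfl, covariance_sub_left]
  have h2 : ∀ s, covariance (p s) (v (s + 1)) (fwdDiff 1 (fwdDiff 1 v) s) =
      covariance (p s) (v (s + 1)) (fwdDiff 1 v (s + 1)) -
        covariance (p s) (v (s + 1)) (fwdDiff 1 v s) := fun s => by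
    rw [← covariance_sub_right]; rfl
  induction M with
  | zero => simp [h1]
  | succ M ih =>
    rw [sum_range_succ, ih, sum_range_succ _ M, h1, h2]
    ring

/-- Approximate log-convexity of the summed variances of successive difference sequences. -/
theorem sum_variance_fwdDiff_le (hζ : 0 ≤ ζ) (hζ1 : ζ ≤ 1) (hp : ∀ s j, 0 ≤ p s j)
    (hp1 : ∀ s, ∑ j, p s j = 1) (hclose : ∀ s, RatioClose ζ (p s) (p (s + 1))) {a b : ℝ}
    (ha : 0 ≤ a) (hb : 0 ≤ b) (hva : ∀ s j, |v s j| ≤ a) (hvb : ∀ s j, |fwdDiff 1 v s j| ≤ b)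
    (M : ℕ) :
    ∑ s ∈ range (M + 1), variance (p s) (fwdDiff 1 v s) ≤
      (1 + ζ) * (√(∑ s ∈ range (M + 2), variance (p s) (v s)) *
        √(∑ s ∈ range M, variance (p s) (fwdDiff 1 (fwdDiff 1 v) s))) +
      3 * ζ * (√(∑ s ∈ range (M + 2), variance (p s) (v s)) *
        √(∑ s ∈ range (M + 1), variance (p s) (fwdDiff 1 v s))) + 2 * (a * b) := by
  have hv0 : ∀ s w, 0 ≤ variance (p s) w := fun s w => variance_nonneg (hp s) w
  -- The terms left by summation by parts sit at index `s + 1`; the longer ranges in the bound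
  -- absorb this shift, each difference costing one index.
  have hshift : ∀ (w : ℕ → Fin n → ℝ) (N N' : ℕ), N < N' →
      ∑ s ∈ range N, variance (p (s + 1)) (w (s + 1)) ≤
        ∑ s ∈ range N', variance (p s) (w s) := by
    intro w N N' hN
    calc _ ≤ ∑ s ∈ range (N + 1), variance (p s) (w s) := by
          rw [sum_range_succ']
          exact le_add_of_nonneg_right (hv0 _ _)
      _ ≤ _ := sum_le_sum_of_subset_of_nonneg (range_subset_range.2 hN) fun s _ _ => hv0 _ _
  have hA := Real.sqrt_le_sqrt (hshift v M (M + 2) (by omega))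
  have hB := Real.sqrt_le_sqrt (hshift (fwdDiff 1 v) M (M + 1) (by omega))
  have hend : covariance (p M) (v (M + 1)) (fwdDiff 1 v M) -
      covariance (p 0) (v 0) (fwdDiff 1 v 0) ≤ 2 * (a * b) := by
    have h1 := abs_covariance_le_mul (hp M) (hp1 M) ha hb (hva (M + 1)) (hvb M)
    have h2 := abs_covariance_le_mul (hp 0) (hp1 0) ha hb (hva 0) (hvb 0)
    linarith [(abs_le.1 h1).2, (abs_le.1 h2).1]
  have hmove : ∑ s ∈ range M, (covariance (p s) (v (s + 1)) (fwdDiff 1 v (s + 1)) -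
      covariance (p (s + 1)) (v (s + 1)) (fwdDiff 1 v (s + 1))) ≤
      3 * ζ * (√(∑ s ∈ range (M + 2), variance (p s) (v s)) *
        √(∑ s ∈ range (M + 1), variance (p s) (fwdDiff 1 v s))) := by
    calc _ ≤ ∑ s ∈ range M, 3 * ζ * (√(variance (p (s + 1)) (v (s + 1))) *
          √(variance (p (s + 1)) (fwdDiff 1 v (s + 1)))) :=
          sum_le_sum fun s _ => (le_abs_self _).trans
            (abs_covariance_sub_le hζ hζ1 (hp s) (hp _) (hp1 _) (hclose s) _ _)
      _ ≤ _ := by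
          rw [← mul_sum]
          refine mul_le_mul_of_nonneg_left ?_ (by linarith)
          exact (Real.sum_sqrt_mul_sqrt_le _ (fun s => hv0 _ _) fun s => hv0 _ _).trans
            (mul_le_mul hA hB (Real.sqrt_nonneg _) (Real.sqrt_nonneg _))
  have hsecond : ∑ s ∈ range M, -covariance (p s) (v (s + 1)) (fwdDiff 1 (fwdDiff 1 v) s) ≤
      (1 + ζ) * (√(∑ s ∈ range (M + 2), variance (p s) (v s)) *
        √(∑ s ∈ range M, variance (p s) (fwdDiff 1 (fwdDiff 1 v) s))) := by
    calc _ ≤ ∑ s ∈ range M, (1 + ζ) * (√(variance (p (s + 1)) (v (s + 1))) *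
          √(variance (p s) (fwdDiff 1 (fwdDiff 1 v) s))) := by
          refine sum_le_sum fun s _ => (neg_le_abs _).trans
            ((abs_covariance_le (hp s) (hp1 s) _ _).trans ?_)
          rw [← mul_assoc]
          refine mul_le_mul_of_nonneg_right ?_ (Real.sqrt_nonneg _)
          refine (Real.sqrt_le_sqrt (variance_le_of_ratioClose hζ (hp s) (hp1 s) (hp (s + 1))
            (hp1 _) (hclose s) _)).trans (le_of_eq ?_)
          rw [Real.sqrt_mul (by positivity), Real.sqrt_sq (by linarith)]
      _ ≤ _ := by
          rw [← mul_sum]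
          refine mul_le_mul_of_nonneg_left ?_ (by linarith)
          exact (Real.sum_sqrt_mul_sqrt_le _ (fun s => hv0 _ _) fun s => hv0 _ _).trans
            (mul_le_mul_of_nonneg_right hA (Real.sqrt_nonneg _))
  have hsum := sum_covariance_fwdDiff p v M
  rw [← sum_congr rfl fun s _ => variance_eq_covariance (hp1 s) (fwdDiff 1 v s),
    sum_sub_distrib] at hsum
  rw [sum_neg_distrib] at hsecond
  linarith

/-- An approximately log-convex sequence whose first ratio is at least `1 / 2` decays slowly. -/
theorem lower_bound_of_approx_log_convex {a : ℕ → ℝ} {H : ℕ} {ε : ℝ} (ha0 : ∀ h, 0 ≤ a h)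
    (hε0 : 0 < ε) (hεH : ε * H = 1 / 30)
    (hstep : ∀ h, h + 2 ≤ H → a (h + 1) ≤ (1 + ε) * (√(a h) * √(a (h + 2))) +
      ε * (√(a h) * √(a (h + 1))) + 18 * (9 / 25 : ℝ) ^ h)
    (hbase : (1 / 2) * a 0 + 540 * H < a 1) (h : ℕ) (hh : h + 1 ≤ H) :
    540 * H * (9 / 25 : ℝ) ^ h ≤ a (h + 1) := by
  have hH0 : (0 : ℝ) < H := by exact_mod_cast (by omega : 0 < H)
  -- The ratio of square roots starts at `7/10`, as `(7/10)² < 1/2`, and loses `3ε` per step. The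
  -- total loss is at most `3εH = 1/10`, so it stays above `6/10`, whose square is `9/25`.
  suffices hclaim : (7 / 10 - 3 * ε * h) * √(a h) ≤ √(a (h + 1)) ∧
      540 * H * (9 / 25 : ℝ) ^ h ≤ a (h + 1) from hclaim.2
  induction h with
  | zero =>
    refine ⟨?_, by rw [pow_zero, zero_add]; linarith [ha0 0]⟩
    simp only [Nat.cast_zero, mul_zero, sub_zero, zero_add]
    refine Real.le_sqrt_of_sq_le ?_
    rw [mul_pow, Real.sq_sqrt (ha0 0)]
    linarith [ha0 0]
  | succ h ih =>
    obtain ⟨hr, hlow⟩ := ih (by omega)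
    have hst := hstep h (by omega)
    have hhH : ((h : ℝ) + 1) ≤ H := by exact_mod_cast (by omega : h + 1 ≤ H)
    have hpos : 0 < a (h + 1) := lt_of_lt_of_le (by positivity) hlow
    -- The constant is `540 = 18 * 30`: with `ε = 1/(30H)` the boundary term is absorbed into `ε * a
    -- (h + 1)`.
    have hbd : 18 * (9 / 25 : ℝ) ^ h ≤ ε * a (h + 1) := by
      have := mul_le_mul_of_nonneg_left hlow hε0.le
      have h5 : ε * (540 * H * (9 / 25 : ℝ) ^ h) = 540 * (ε * H) * (9 / 25 : ℝ) ^ h := by ring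
      rw [h5, hεH] at this
      linarith
    have hyy : a (h + 1) = √(a (h + 1)) * √(a (h + 1)) := (Real.mul_self_sqrt (ha0 _)).symm
    have hzz : a (h + 1 + 1) = √(a (h + 2)) * √(a (h + 2)) := (Real.mul_self_sqrt (ha0 _)).symm
    have hy0 : 0 < √(a (h + 1)) := Real.sqrt_pos.2 hpos
    have hx0 : 0 ≤ √(a h) := Real.sqrt_nonneg _
    have hz0 : 0 ≤ √(a (h + 2)) := Real.sqrt_nonneg _
    suffices hs : (7 / 10 - 3 * ε * ((h + 1 : ℕ) : ℝ)) * √(a (h + 1)) ≤ √(a (h + 2)) ∧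
        540 * H * (9 / 25 : ℝ) ^ (h + 1) ≤ √(a (h + 2)) * √(a (h + 2)) from
      ⟨hs.1, by rw [hzz]; exact hs.2⟩
    rw [hyy] at hbd hlow
    nth_rewrite 1 [hyy] at hst
    generalize √(a h) = x at *
    generalize √(a (h + 1)) = y at *
    generalize √(a (h + 2)) = z at *
    obtain ⟨r, hrdef⟩ : ∃ r, r = 7 / 10 - 3 * ε * h := ⟨_, rfl⟩
    rw [← hrdef] at hr
    have hεh : ε * (h + 1) ≤ 1 / 30 := by
      rw [← hεH]; exact mul_le_mul_of_nonneg_left hhH hε0.le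
    have hr0 : 6 / 10 + 3 * ε ≤ r := by rw [hrdef]; linarith
    have hr1 : r ≤ 1 := by
      have : 0 ≤ 3 * ε * h := by positivity
      rw [hrdef]; linarith
    -- Substitute `r * x ≤ y` from the previous ratio into the log-convexity inequality and cancel
    -- `y > 0`.
    have hmain : r * (1 - ε) * y ≤ (1 + ε) * z + ε * y := by
      have h6 : y * y * (1 - ε) ≤ x * ((1 + ε) * z + ε * y) := by linarith
      have h7 : r * (y * y * (1 - ε)) ≤ y * ((1 + ε) * z + ε * y) := by
        calc r * (y * y * (1 - ε)) ≤ r * (x * ((1 + ε) * z + ε * y)) :=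
              mul_le_mul_of_nonneg_left h6 (by linarith)
          _ = (r * x) * ((1 + ε) * z + ε * y) := by ring
          _ ≤ _ := mul_le_mul_of_nonneg_right hr (by positivity)
      refine le_of_mul_le_mul_left ?_ hy0
      linarith
    have hfin : (r - 3 * ε) * y ≤ z := by
      have h8 : (1 + ε) * ((r - 3 * ε) * y) ≤ (1 + ε) * z := by
        have h9 : (1 + ε) * (r - 3 * ε) ≤ r * (1 - ε) - ε := by
          linarith [mul_nonneg hε0.le (sub_nonneg.2 hr1), mul_pos hε0 hε0]
        have := mul_le_mul_of_nonneg_right h9 hy0.le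
        linarith
      exact le_of_mul_le_mul_left h8 (by linarith)
    refine ⟨?_, ?_⟩
    · have h10 : (7 / 10 - 3 * ε * ((h + 1 : ℕ) : ℝ)) = r - 3 * ε := by
        rw [hrdef]; push_cast; ring
      rw [h10]
      exact hfin
    · have h11 : 6 / 10 * y ≤ z :=
        (mul_le_mul_of_nonneg_right (by linarith) hy0.le).trans hfin
      have h12 : (6 / 10 * y) * (6 / 10 * y) ≤ z * z :=
        mul_self_le_mul_self (by positivity) h11
      rw [pow_succ]
      linarith

/-- If the iterated differences of `v` decay geometrically, the summed variance of the first
differences of `v` is at most half that of `v`, up to a logarithmic error. -/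
theorem sum_variance_fwdDiff_le_half {H N : ℕ} (hH : 1 ≤ H) (hHN : H ≤ N) (hN : N ≤ 2 ^ H)
    (hζ : 0 ≤ ζ) (hζH : ζ * (90 * H) ≤ 1) (hp : ∀ s j, 0 ≤ p s j)
    (hp1 : ∀ s, ∑ j, p s j = 1) (hclose : ∀ s, RatioClose ζ (p s) (p (s + 1))) {δ : ℝ}
    (hδ0 : 0 ≤ δ) (hδ : δ ≤ 2 / 5)
    (hv : ∀ h ≤ H, ∀ s j, |(fwdDiff 1)^[h] v s j| ≤ 3 * δ ^ h) :
    ∑ s ∈ range (N - 1), variance (p s) (fwdDiff 1 v s) ≤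
      (1 / 2) * ∑ s ∈ range N, variance (p s) (v s) + 540 * H := by
  by_contra! hcon
  have hH' : (1 : ℝ) ≤ H := by exact_mod_cast hH
  obtain ⟨a, ha⟩ : ∃ a : ℕ → ℝ, ∀ h,
      a h = ∑ s ∈ range (N - h), variance (p s) ((fwdDiff 1)^[h] v s) := ⟨_, fun _ => rfl⟩
  have ha0 : ∀ h, 0 ≤ a h := fun h => by
    rw [ha]
    exact sum_nonneg fun s _ => variance_nonneg (hp s) _
  obtain ⟨ε, hε⟩ : ∃ ε : ℝ, ε = 1 / (30 * H) := ⟨_, rfl⟩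
  have hε0 : 0 < ε := by rw [hε]; positivity
  have hεH : ε * H = 1 / 30 := by rw [hε]; field_simp
  have hζε : 3 * ζ ≤ ε := by
    rw [hε, le_div_iff₀ (by positivity)]
    linarith
  have hζ1 : ζ ≤ 1 := by nlinarith
  have hδ2 : δ ^ 2 ≤ 4 / 25 := by
    calc δ ^ 2 ≤ (2 / 5) ^ 2 := pow_le_pow_left₀ hδ0 hδ 2
      _ = _ := by norm_num
  have hstep : ∀ h, h + 2 ≤ H → a (h + 1) ≤ (1 + ε) * (√(a h) * √(a (h + 2))) +
      ε * (√(a h) * √(a (h + 1))) + 18 * (9 / 25 : ℝ) ^ h := by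
    intro h hh
    have key := sum_variance_fwdDiff_le (v := (fwdDiff 1)^[h] v) hζ hζ1 hp hp1 hclose
      (a := 3 * δ ^ h) (b := 3 * δ ^ (h + 1)) (by positivity) (by positivity)
      (fun s j => hv h (by omega) s j)
      (fun s j => by
        have := hv (h + 1) (by omega) s j
        rwa [Function.iterate_succ_apply'] at this) (N - (h + 2))
    rw [show N - (h + 2) + 1 = N - (h + 1) by omega, show N - (h + 2) + 2 = N - h by omega,
      ← Function.iterate_succ_apply' (fwdDiff 1), ← Function.iterate_succ_apply' (fwdDiff 1),
      ← ha h, ← ha (h + 1), ← ha (h + 2)] at key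
    have h1 : (1 + ζ) * (√(a h) * √(a (h + 2))) ≤ (1 + ε) * (√(a h) * √(a (h + 2))) :=
      mul_le_mul_of_nonneg_right (by linarith) (by positivity)
    have h2 : 3 * ζ * (√(a h) * √(a (h + 1))) ≤ ε * (√(a h) * √(a (h + 1))) :=
      mul_le_mul_of_nonneg_right hζε (by positivity)
    have h3 : 2 * (3 * δ ^ h * (3 * δ ^ (h + 1))) ≤ 18 * (9 / 25 : ℝ) ^ h := by
      have h4 : 2 * (3 * δ ^ h * (3 * δ ^ (h + 1))) = 18 * ((δ ^ 2) ^ h * δ) := by ring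
      rw [h4]
      refine mul_le_mul_of_nonneg_left ?_ (by norm_num)
      calc (δ ^ 2) ^ h * δ ≤ (9 / 25 : ℝ) ^ h * 1 :=
            mul_le_mul (pow_le_pow_left₀ (sq_nonneg _) (by linarith) _) (by linarith) hδ0
              (by positivity)
        _ = _ := mul_one _
    linarith
  obtain ⟨k, rfl⟩ : ∃ k, H = k + 1 := ⟨H - 1, by omega⟩
  have hlast := lower_bound_of_approx_log_convex ha0 hε0 hεH hstep
    (by rw [ha 0, ha 1]; exact hcon) k le_rfl
  -- At the top order the trivial bound wins: at most `2 ^ H` terms, each at most `9 δ ^ (2H)`, and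
  -- `2 δ² ≤ 8/25 < 9/25`.
  have hup : a (k + 1) ≤ 2 ^ (k + 1) * (3 * δ ^ (k + 1)) ^ 2 := by
    calc a (k + 1) ≤ ∑ s ∈ range (N - (k + 1)), (3 * δ ^ (k + 1)) ^ 2 := by
          rw [ha]
          exact sum_le_sum fun s _ => variance_le_sq (hp s) (hp1 s) (hv (k + 1) le_rfl s)
      _ = ((N - (k + 1) : ℕ) : ℝ) * (3 * δ ^ (k + 1)) ^ 2 := by
          rw [sum_const, card_range, nsmul_eq_mul]
      _ ≤ _ := by
          refine mul_le_mul_of_nonneg_right ?_ (sq_nonneg _)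
          exact_mod_cast (Nat.sub_le _ _).trans hN
  have h13 : (2 : ℝ) ^ (k + 1) * (3 * δ ^ (k + 1)) ^ 2 = 9 * (2 * δ ^ 2) ^ (k + 1) := by
    rw [mul_pow 2 (δ ^ 2), ← pow_mul]; ring
  have h14 : (2 * δ ^ 2) ^ (k + 1) ≤ (9 / 25 : ℝ) ^ (k + 1) :=
    pow_le_pow_left₀ (by positivity) (by linarith) _
  have h15 : (0 : ℝ) < (9 / 25 : ℝ) ^ k := by positivity
  rw [h13] at hup
  rw [pow_succ (9 / 25 : ℝ) k] at h14
  have h16 : (540 : ℝ) * (9 / 25 : ℝ) ^ k ≤ 540 * ((k + 1 : ℕ) : ℝ) * (9 / 25 : ℝ) ^ k :=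
    mul_le_mul_of_nonneg_right (by linarith) h15.le
  linarith

end SummationByParts

/-! ### Higher-order smoothness of the losses in self-play -/

section Weights

variable {n : ℕ}

theorem optHedgeIter_pos (hn : 0 < n) (η : ℝ) (l : ℕ → Fin n → ℝ) (t : ℕ) (j : Fin n) :
    0 < optHedgeIter η l t j :=
  (optHedgeIter_pos_and_sum hn η l t).1 j

theorem sum_optHedgeIter (hn : 0 < n) (η : ℝ) (l : ℕ → Fin n → ℝ) (t : ℕ) :
    ∑ j, optHedgeIter η l t j = 1 :=
  (optHedgeIter_pos_and_sum hn η l t).2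

/-- The logarithmic weight accumulated by action `j` in the `s` rounds after round `τ + 1`. -/
noncomputable def logWeight (η : ℝ) (l : ℕ → Fin n → ℝ) (τ : ℕ) (j : Fin n) (s : ℕ) : ℝ :=
  ∑ r ∈ range s, -η * (2 * l (τ + r + 1) j - l (τ + r) j)

/-- The normalizers cancel along the recursion. Starting from the iterate at `τ + 1` rather than the
uniform one keeps the log-weights small over a short window. -/
theorem optHedgeIter_eq_softmax (hn : 0 < n) (η : ℝ) (l : ℕ → Fin n → ℝ) (τ s : ℕ) (j : Fin n) :
    optHedgeIter η l (τ + 1 + s) j =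
      optHedgeIter η l (τ + 1) j * Real.exp (logWeight η l τ j s) /
        ∑ k, optHedgeIter η l (τ + 1) k * Real.exp (logWeight η l τ k s) := by
  induction s generalizing j with
  | zero => simp [logWeight, sum_optHedgeIter hn]
  | succ s ih =>
    have : Nonempty (Fin n) := ⟨⟨0, hn⟩⟩
    have hS : ∑ k, optHedgeIter η l (τ + 1) k * Real.exp (logWeight η l τ k s) ≠ 0 :=
      (sum_pos (fun k _ => mul_pos (optHedgeIter_pos hn _ _ _ k) (Real.exp_pos _))
        univ_nonempty).ne'
    have hw : ∀ k, Real.exp (logWeight η l τ k (s + 1)) = Real.exp (logWeight η l τ k s) *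
        Real.exp (-η * (2 * l (τ + s + 1) k - l (τ + s) k)) := fun k => by
      rw [logWeight, sum_range_succ, Real.exp_add]; rfl
    have hx : optHedgeIter η l (τ + s + 1) = optHedgeIter η l (τ + 1 + s) := by
      rw [show τ + s + 1 = τ + 1 + s by ring]
    rw [show τ + 1 + (s + 1) = τ + s + 2 by ring, optHedgeIter]
    simp only [hx, ih, hw, div_mul_eq_mul_div, ← sum_div, ← mul_assoc]
    rw [div_div_div_cancel_right₀ hS]

theorem abs_logWeight_le {η : ℝ} (hη : 0 ≤ η) {l : ℕ → Fin n → ℝ}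
    (hl : ∀ t j, l t j ∈ Set.Icc (0 : ℝ) 1) (τ : ℕ) (j : Fin n) (s : ℕ) :
    |logWeight η l τ j s| ≤ 2 * η * s := by
  calc |logWeight η l τ j s| ≤ ∑ r ∈ range s, 2 * η := by
        refine (abs_sum_le_sum_abs _ _).trans (sum_le_sum fun r _ => ?_)
        rw [abs_mul, abs_neg, abs_of_nonneg hη, mul_comm]
        refine mul_le_mul_of_nonneg_right ?_ hη
        have h1 := hl (τ + r + 1) j
        have h2 := hl (τ + r) j
        rw [abs_le]
        constructor <;> linarith [h1.1, h1.2, h2.1, h2.2]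
    _ = _ := by rw [sum_const, card_range, nsmul_eq_mul]; ring

/-- A difference of the weights is `η` times a difference of the losses of one order less; this gain
drives the induction on the order. -/
theorem fwdDiff_iter_logWeight (η : ℝ) (l : ℕ → Fin n → ℝ) (τ : ℕ) (j : Fin n) (h s : ℕ) :
    (fwdDiff 1)^[h + 1] (logWeight η l τ j) s =
      -η * (2 * (fwdDiff 1)^[h] (fun t => l t j) (τ + s + 1) -
        (fwdDiff 1)^[h] (fun t => l t j) (τ + s)) := by
  induction h generalizing s with
  | zero =>
    simp only [zero_add, Function.iterate_one, Function.iterate_zero, id]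
    rw [fwdDiff, logWeight, logWeight, sum_range_succ]
    ring
  | succ h ih =>
    rw [fwdDiff_iter_succ_apply, ih, ih, fwdDiff_iter_succ_apply, fwdDiff_iter_succ_apply]
    rw [show τ + (s + 1) = τ + s + 1 by ring]
    ring

/-- Along Optimistic Hedge, consecutive strategies are close. -/
theorem ratioClose_optHedgeIter (hn : 0 < n) {η : ℝ} (hη : 0 ≤ η) (hη1 : η ≤ 1 / 4)
    {l : ℕ → Fin n → ℝ} (hl : ∀ t j, l t j ∈ Set.Icc (0 : ℝ) 1) (τ : ℕ) :
    RatioClose (8 * η) (optHedgeIter η l (τ + 1)) (optHedgeIter η l (τ + 1 + 1)) := by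
  intro j
  have hw : ∀ k, |logWeight η l τ k 1| ≤ 2 * η := fun k => by
    simpa using abs_logWeight_le hη hl τ k 1
  have hp := fun k => optHedgeIter_pos hn η l (τ + 1) k
  have hp1 := sum_optHedgeIter hn η l (τ + 1)
  have hup : ∀ k, Real.exp (logWeight η l τ k 1) ≤ Real.exp (2 * η) := fun k =>
    Real.exp_le_exp.2 (abs_le.1 (hw k)).2
  have hlo : ∀ k, Real.exp (-(2 * η)) ≤ Real.exp (logWeight η l τ k 1) := fun k =>
    Real.exp_le_exp.2 (abs_le.1 (hw k)).1
  have hSup : ∑ k, optHedgeIter η l (τ + 1) k * Real.exp (logWeight η l τ k 1) ≤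
      Real.exp (2 * η) := by
    calc _ ≤ ∑ k, optHedgeIter η l (τ + 1) k * Real.exp (2 * η) :=
          sum_le_sum fun k _ => mul_le_mul_of_nonneg_left (hup k) (hp k).le
      _ = _ := by rw [← sum_mul, hp1, one_mul]
  have hSlo : Real.exp (-(2 * η)) ≤
      ∑ k, optHedgeIter η l (τ + 1) k * Real.exp (logWeight η l τ k 1) := by
    calc _ = ∑ k, optHedgeIter η l (τ + 1) k * Real.exp (-(2 * η)) := by
          rw [← sum_mul, hp1, one_mul]
      _ ≤ _ := sum_le_sum fun k _ => mul_le_mul_of_nonneg_left (hlo k) (hp k).le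
  -- Numerator and normalizer each move by a factor within `exp (±2η)`, so the quotient moves by at
  -- most `exp (4η)`.
  have hexp : Real.exp (4 * η) ≤ 1 + 8 * η := by
    have := (abs_le.1 (Real.abs_exp_sub_one_sub_id_le (x := 4 * η)
      (by rw [abs_of_nonneg (by linarith)]; linarith))).2
    nlinarith
  have hSpos := (Real.exp_pos _).trans_le hSlo
  have e1 : Real.exp (2 * η) = Real.exp (4 * η) * Real.exp (-(2 * η)) := by
    rw [← Real.exp_add]; ring_nf
  rw [optHedgeIter_eq_softmax hn η l τ 1 j]
  constructor
  · rw [← mul_div_assoc, le_div_iff₀ hSpos, mul_left_comm]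
    refine mul_le_mul_of_nonneg_left (hSup.trans ?_) (hp j).le
    rw [e1]
    exact mul_le_mul hexp (hlo j) (Real.exp_pos _).le (by linarith)
  · rw [div_le_iff₀ hSpos, mul_comm (1 + 8 * η), mul_assoc]
    refine mul_le_mul_of_nonneg_left ((hup j).trans ?_) (hp j).le
    rw [e1]
    exact mul_le_mul hexp hSlo (Real.exp_pos _).le (by linarith)

end Weights

/-! ### Multilinearity of the losses and decay of their differences -/

section Play

variable {m : ℕ} {n : Fin m → ℕ}

/-- Replacing the `i`-th factor by the indicator of `j` makes the sum over profiles a full product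
of sums. -/
theorem sum_ite_prod_erase (i : Fin m) (j : Fin (n i)) (f : ∀ k, Fin (n k) → ℝ) :
    ∑ a : ∀ k, Fin (n k), (if a i = j then ∏ k ∈ univ.erase i, f k (a k) else 0) =
      ∏ k ∈ univ.erase i, ∑ b, f k b := by
  classical
  let g : ∀ k, Fin (n k) → ℝ := Function.update f i fun b => if b = j then 1 else 0
  have hg : ∀ k ∈ univ.erase i, g k = f k := fun k hk =>
    Function.update_of_ne (ne_of_mem_erase hk) _ _
  have h1 : ∏ k, ∑ b, g k b = ∏ k ∈ univ.erase i, ∑ b, f k b := by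
    rw [← mul_prod_erase univ _ (mem_univ i)]
    rw [prod_congr rfl fun k hk => by rw [hg k hk]]
    simp [g]
  rw [← h1, prod_univ_sum, Fintype.piFinset_univ]
  refine sum_congr rfl fun a _ => ?_
  have h2 : ∏ k ∈ univ.erase i, g k (a k) = ∏ k ∈ univ.erase i, f k (a k) :=
    prod_congr rfl fun k hk => by rw [hg k hk]
  rw [← mul_prod_erase univ _ (mem_univ i), h2]
  simp [g]

theorem Game.lossVector_mem_Icc (G : Game m n) {x : ∀ k, Fin (n k) → ℝ}
    (hx : ∀ k b, 0 ≤ x k b) (hx1 : ∀ k, ∑ b, x k b = 1) (i : Fin m) (j : Fin (n i)) :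
    G.lossVector x i j ∈ Set.Icc (0 : ℝ) 1 := by
  have hprod : ∀ a : ∀ k, Fin (n k), 0 ≤ ∏ k ∈ univ.erase i, x k (a k) := fun a =>
    prod_nonneg fun k _ => hx k _
  constructor
  · refine sum_nonneg fun a _ => ?_
    split_ifs
    · exact mul_nonneg (hprod a) (G.loss_mem i a).1
    · exact le_rfl
  · calc G.lossVector x i j ≤
        ∑ a : ∀ k, Fin (n k), (if a i = j then ∏ k ∈ univ.erase i, x k (a k) else 0) := by
          refine sum_le_sum fun a _ => ?_
          split_ifs
          · exact mul_le_of_le_one_right (hprod a) (G.loss_mem i a).2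
          · exact le_rfl
      _ = 1 := by simp [sum_ite_prod_erase, hx1]

/-- The losses `l` are those of repeated play of `G` in which all players use Optimistic Hedge
with step size `η`. -/
structure Game.IsOptHedgePlay (G : Game m n) (η : ℝ) (l : ∀ i, ℕ → Fin (n i) → ℝ) : Prop where
  zero : ∀ i, l i 0 = 0
  eq : ∀ t i, l i (t + 1) = G.lossVector (fun k => optHedgeIter η (l k) (t + 1)) i

variable {G : Game m n} {η : ℝ} {l : ∀ i, ℕ → Fin (n i) → ℝ}

theorem Game.IsOptHedgePlay.mem_Icc (hl : G.IsOptHedgePlay η l) (hn : ∀ i, 1 ≤ n i) (i : Fin m)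
    (t : ℕ) (j : Fin (n i)) : l i t j ∈ Set.Icc (0 : ℝ) 1 := by
  cases t with
  | zero => simp [hl.zero]
  | succ t =>
    rw [hl.eq]
    exact G.lossVector_mem_Icc (fun k b => (optHedgeIter_pos (hn k) _ _ _ _).le)
      (fun k => sum_optHedgeIter (hn k) _ _ _) i j

/-- Loss coefficients lie in `[0,1]`, so the triangle inequality and submultiplicativity leave a
product over the opponents of summed norms. There are `m - 1` factors; `1 ≤ c` allows the exponent
`m`. -/
theorem windowNorm_lossVector_le {K : ℕ} {ρ : ℝ} (hρ : 0 ≤ ρ) (G : Game m n)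
    (x : ∀ k, Fin (n k) → ℕ → ℝ) {c : ℝ} (hc : 1 ≤ c)
    (hx : ∀ k, ∑ b, windowNorm K ρ (x k b) ≤ c) (i : Fin m) (j : Fin (n i)) :
    windowNorm K ρ (fun s => G.lossVector (fun k b => x k b s) i j) ≤ c ^ m := by
  have h0 : ∀ k b, 0 ≤ windowNorm K ρ (x k b) := fun k b => windowNorm_nonneg hρ _
  calc windowNorm K ρ (fun s => G.lossVector (fun k b => x k b s) i j)
      ≤ ∑ a : ∀ k, Fin (n k),
          (if a i = j then ∏ k ∈ univ.erase i, windowNorm K ρ (x k (a k)) else 0) := by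
        refine (windowNorm_le_sum hρ _ _).trans (sum_le_sum fun a _ => ?_)
        split_ifs
        · simp only [mul_comm _ (G.loss i a)]
          rw [windowNorm_const_mul, abs_of_nonneg (G.loss_mem i a).1]
          refine (mul_le_of_le_one_left (windowNorm_nonneg hρ _) (G.loss_mem i a).2).trans ?_
          exact windowNorm_prod_le hρ _ fun k => x k (a k)
        · have := windowNorm_const_mul (K := K) (ρ := ρ) 0 fun _ => 0
          simp only [zero_mul, abs_zero] at this
          exact this.le
    _ = ∏ k ∈ univ.erase i, ∑ b, windowNorm K ρ (x k b) :=
        sum_ite_prod_erase i j fun k b => windowNorm K ρ (x k b)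
    _ ≤ ∏ k ∈ univ.erase i, c :=
        prod_le_prod (fun k _ => sum_nonneg fun b _ => h0 k b) fun k _ => hx k
    _ ≤ c ^ m := by
        rw [prod_const]
        exact pow_le_pow_right₀ hc (by simp)

/-- In self-play of Optimistic Hedge, the iterated differences of the losses decay
geometrically. -/
theorem Game.IsOptHedgePlay.abs_fwdDiff_iter_le_factorial (hl : G.IsOptHedgePlay η l)
    (hn : ∀ i, 1 ≤ n i) (hm : 1 ≤ m) {H : ℕ} (hH : 1 ≤ H) (hη : 0 < η)
    (hηH : 16 * m * H * η ≤ 1) (h : ℕ) (hh : h ≤ H) (i : Fin m) (j : Fin (n i)) (τ : ℕ)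
    (hτ : h ≤ τ) :
    |(fwdDiff 1)^[h] (fun t => l i t j) (τ + 1)| ≤ h.factorial * (72 * η * m * H) ^ h * 3 := by
  have hm' : (1 : ℝ) ≤ m := by exact_mod_cast hm
  have hH' : (1 : ℝ) ≤ H := by exact_mod_cast hH
  induction h using Nat.strong_induction_on generalizing i τ with
  | _ K ih =>
  have hK' : (K : ℝ) ≤ H := by exact_mod_cast hh
  -- The budget for the log-weights is `1/(4m)`: each softmax then has total norm at most `1 + 1/m`,
  -- and `(1 + 1/m) ^ m ≤ e`. Order `0` uses half of it, `2ηK ≤ 1/(8m)`; the positive orders use at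
  -- most `9ηρH = 1/(8m)`, whence `72 = 9 * 8`.
  obtain ⟨ρ, hρ⟩ : ∃ ρ : ℝ, ρ = 1 / (72 * η * m * H) := ⟨_, rfl⟩
  have hρ0 : 0 < ρ := by rw [hρ]; positivity
  have hρinv : 72 * η * m * H = ρ⁻¹ := by rw [hρ, one_div, inv_inv]
  have hw : ∀ k b, windowNorm K ρ (logWeight η (l k) τ b) ≤ 1 / (4 * m) := by
    intro k b
    have h0 : windowSup K 0 (logWeight η (l k) τ b) ≤ 2 * η * K := by
      refine windowSup_le fun s hs => (abs_logWeight_le hη.le (hl.mem_Icc hn k) τ b s).trans ?_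
      have : (s : ℝ) ≤ K := by exact_mod_cast hs
      exact mul_le_mul_of_nonneg_left this (by positivity)
    have h1 : ∀ h < K, ρ ^ (h + 1) / (h + 1).factorial *
        windowSup K (h + 1) (logWeight η (l k) τ b) ≤ 9 * η * ρ := by
      intro h hhK
      have h2 : windowSup K (h + 1) (logWeight η (l k) τ b) ≤
          9 * η * (h.factorial * (ρ⁻¹) ^ h) := by
        refine windowSup_le fun s hs => ?_
        -- Loss differences are needed at `τ + s` as well as at `τ + s + 1`. So each order costs one
        -- round of burn-in, which keeps the artificial loss `ℓ⁰ = 0` out and explains `h ≤ τ`.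
        have b1 := ih h hhK (by omega) k b (τ + s) (by omega)
        obtain ⟨τ', hτ'⟩ : ∃ τ', τ + s = τ' + 1 := ⟨τ + s - 1, by omega⟩
        have b2 := ih h hhK (by omega) k b τ' (by omega)
        rw [hρinv] at b1 b2
        rw [← hτ'] at b2
        rw [fwdDiff_iter_logWeight, abs_mul, abs_neg, abs_of_pos hη]
        have b3 : |2 * (fwdDiff 1)^[h] (fun t => l k t b) (τ + s + 1) -
            (fwdDiff 1)^[h] (fun t => l k t b) (τ + s)| ≤ 9 * (h.factorial * (ρ⁻¹) ^ h) := by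
          rw [abs_le] at b1 b2 ⊢
          constructor <;> linarith [b1.1, b1.2, b2.1, b2.2]
        calc _ ≤ η * (9 * (h.factorial * (ρ⁻¹) ^ h)) := mul_le_mul_of_nonneg_left b3 hη.le
          _ = _ := by ring
      have hfac : (0 : ℝ) < h.factorial := by positivity
      calc _ ≤ ρ ^ (h + 1) / (h + 1).factorial * (9 * η * (h.factorial * (ρ⁻¹) ^ h)) :=
            mul_le_mul_of_nonneg_left h2 (by positivity)
        _ = 9 * η * ρ / (h + 1) := by
            rw [Nat.factorial_succ, inv_pow]
            push_cast
            field_simp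
            ring
        _ ≤ 9 * η * ρ := div_le_self (by positivity) (by linarith [Nat.cast_nonneg (α := ℝ) h])
    refine (windowNorm_le_of_windowSup h0 h1).trans ?_
    have h3 : 9 * η * ρ * H = 1 / (8 * m) := by
      rw [hρ]; field_simp; norm_num
    have h4 : 2 * η * H ≤ 1 / (8 * m) := by
      rw [le_div_iff₀ (by positivity)]; linarith
    have h5 : (1 : ℝ) / (4 * m) = 1 / (8 * m) + 1 / (8 * m) := by field_simp; norm_num
    have h6 : 2 * η * K ≤ 2 * η * H := mul_le_mul_of_nonneg_left hK' (by positivity)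
    have h7 : 9 * η * ρ * K ≤ 9 * η * ρ * H := mul_le_mul_of_nonneg_left hK' (by positivity)
    linarith
  have hx : ∀ k, ∑ b, windowNorm K ρ (fun s => optHedgeIter η (l k) (τ + 1 + s) b) ≤
      1 + 1 / m := by
    intro k
    simp only [optHedgeIter_eq_softmax (hn k)]
    refine (sum_windowNorm_softmax_le hρ0.le (fun b => optHedgeIter_pos (hn k) _ _ _ b)
      (sum_optHedgeIter (hn k) _ _ _) (by positivity) ?_ (hw k)).trans (le_of_eq ?_)
    · exact one_div_le_one_div_of_le (by norm_num) (by linarith)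
    · field_simp
  have hnorm := windowNorm_lossVector_le hρ0.le G
    (fun k b s => optHedgeIter η (l k) (τ + 1 + s) b)
    (le_add_of_nonneg_right (by positivity)) hx i j
  have hc : (1 + 1 / (m : ℝ)) ^ m ≤ 3 := by
    calc (1 + 1 / (m : ℝ)) ^ m ≤ Real.exp (1 / m) ^ m :=
          pow_le_pow_left₀ (by positivity) (by linarith [Real.add_one_le_exp (1 / (m : ℝ))]) _
      _ = Real.exp 1 := by rw [← Real.exp_nat_mul, mul_one_div_cancel (by positivity)]
      _ ≤ 3 := by linarith [Real.exp_one_lt_d9]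
  have hshift := fwdDiff_iter_comp_add 1 (fun t => l i t j) (τ + 1) K 0
  rw [zero_add] at hshift
  have hfun : (fun s => l i (s + (τ + 1)) j) =
      fun s => G.lossVector (fun k b => optHedgeIter η (l k) (τ + 1 + s) b) i j := by
    funext s
    rw [show s + (τ + 1) = τ + s + 1 by ring, hl.eq, show τ + s + 1 = τ + 1 + s by ring]
  rw [← hshift, hfun]
  refine (abs_fwdDiff_iter_le_windowNorm hρ0 _).trans ?_
  rw [hρinv, inv_pow, ← div_eq_mul_inv]
  exact mul_le_mul_of_nonneg_left (hnorm.trans hc) (by positivity)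

/-- Since `h! ≤ H ^ h` for `h ≤ H`, factorial growth becomes geometric at the price of one more
factor `H` in the base. -/
theorem Game.IsOptHedgePlay.abs_fwdDiff_iter_le (hl : G.IsOptHedgePlay η l)
    (hn : ∀ i, 1 ≤ n i) (hm : 1 ≤ m) {H : ℕ} (hH : 1 ≤ H) (hη : 0 < η)
    (hηH : 16 * m * H * η ≤ 1) (h : ℕ) (hh : h ≤ H) (i : Fin m) (j : Fin (n i)) (τ : ℕ)
    (hτ : h ≤ τ) :
    |(fwdDiff 1)^[h] (fun t => l i t j) (τ + 1)| ≤ 3 * (72 * η * m * H ^ 2) ^ h := by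
  refine (hl.abs_fwdDiff_iter_le_factorial hn hm hH hη hηH h hh i j τ hτ).trans ?_
  have h1 : (h.factorial : ℝ) ≤ H ^ h := by
    calc (h.factorial : ℝ) ≤ (h : ℝ) ^ h := by exact_mod_cast Nat.factorial_le_pow h
      _ ≤ _ := pow_le_pow_left₀ (by positivity) (by exact_mod_cast hh) _
  calc _ ≤ (H : ℝ) ^ h * (72 * η * m * H) ^ h * 3 := by gcongr
    _ = _ := by rw [← mul_pow]; ring

end Play

theorem sum_Icc_one_eq_sum_range (f : ℕ → ℝ) (T : ℕ) :
    ∑ t ∈ Icc 1 T, f t = ∑ s ∈ range T, f (s + 1) := by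
  induction T with
  | zero => simp
  | succ T ih => rw [sum_Icc_succ_top (by omega), ih, sum_range_succ]

/-! ### The variation of the losses in self-play -/

section Variation

theorem fwdDiff_iter_apply_apply {n : ℕ} (v : ℕ → Fin n → ℝ) (h s : ℕ) (j : Fin n) :
    (fwdDiff 1)^[h] v s j = (fwdDiff 1)^[h] (fun t => v t j) s := by
  induction h generalizing s with
  | zero => rfl
  | succ h ih =>
    rw [fwdDiff_iter_succ_apply, ← ih, ← ih, Function.iterate_succ_apply']
    rfl

theorem variance_le_one {n : ℕ} {P : Fin n → ℝ} (h0 : ∀ j, 0 ≤ P j) (h1 : ∑ j, P j = 1)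
    {u w : Fin n → ℝ} (hu : ∀ j, u j ∈ Set.Icc (0 : ℝ) 1) (hw : ∀ j, w j ∈ Set.Icc (0 : ℝ) 1) :
    variance P (u - w) ≤ 1 := by
  have := variance_le_sq h0 h1 (v := u - w) (a := 1) fun j => by
    rw [Pi.sub_apply, abs_le]
    constructor <;> linarith [(hu j).1, (hu j).2, (hw j).1, (hw j).2]
  simpa using this

variable {m : ℕ} {n : Fin m → ℕ} {G : Game m n} {η : ℝ} {l : ∀ i, ℕ → Fin (n i) → ℝ}

/-- In self-play of Optimistic Hedge, the variation of the losses is at most half their second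
order moment, up to a logarithmic error. -/
theorem Game.IsOptHedgePlay.sum_variance_le (hl : G.IsOptHedgePlay η l)
    (hn : ∀ i, 1 ≤ n i) (hm : 1 ≤ m) {H T₀ : ℕ} (hH : 1 ≤ H) (hη : 0 < η)
    (hηH : 720 * η * m * H ^ 2 ≤ 1) (hT : T₀ ≤ 2 ^ H) (i : Fin m) :
    ∑ t ∈ Icc 1 T₀, variance (optHedgeIter η (l i) t) (l i t - l i (t - 1)) ≤
      (1 / 2) * ∑ t ∈ Icc 1 T₀, variance (optHedgeIter η (l i) t) (l i (t - 1)) + 543 * H := by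
  have hm' : (1 : ℝ) ≤ m := by exact_mod_cast hm
  have hH' : (1 : ℝ) ≤ H := by exact_mod_cast hH
  rw [sum_Icc_one_eq_sum_range, sum_Icc_one_eq_sum_range]
  simp only [Nat.add_sub_cancel]
  have h0 : ∀ t j, 0 ≤ optHedgeIter η (l i) t j := fun t j => (optHedgeIter_pos (hn i) _ _ _ _).le
  have h1 : ∀ t, ∑ j, optHedgeIter η (l i) t j = 1 := fun t => sum_optHedgeIter (hn i) _ _ _
  have hI := hl.mem_Icc hn i
  obtain ⟨F, hF⟩ : ∃ F : ℕ → ℝ, ∀ s, F s =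
      variance (optHedgeIter η (l i) (s + 1)) (l i (s + 1) - l i s) := ⟨_, fun _ => rfl⟩
  obtain ⟨S, hS⟩ : ∃ S : ℕ → ℝ, ∀ s, S s =
      variance (optHedgeIter η (l i) (s + 1)) (l i s) := ⟨_, fun _ => rfl⟩
  simp only [← hF, ← hS]
  have hF1 : ∀ s, F s ≤ 1 := fun s => by
    rw [hF]; exact variance_le_one (h0 _) (h1 _) (hI _) (hI _)
  have hS0 : ∀ s, 0 ≤ S s := fun s => by rw [hS]; exact variance_nonneg (h0 _) _
  have hFN : ∀ k, ∑ s ∈ range k, F s ≤ k := fun k => by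
    simpa using sum_le_sum fun s (_ : s ∈ range k) => hF1 s
  rcases le_or_gt T₀ (2 * H) with hsmall | hlarge
  · have a1 := hFN T₀
    have a2 : (T₀ : ℝ) ≤ 2 * H := by exact_mod_cast hsmall
    have a3 : 0 ≤ ∑ s ∈ range T₀, S s := sum_nonneg fun s _ => hS0 s
    linarith
  -- The first `H + 1` rounds are burn-in, where differences up to order `H` are uncontrolled, and
  -- the last round has no successor. Each costs at most `1`, and `540 H + H + 2 ≤ 543 H`.
  · obtain ⟨N, rfl⟩ : ∃ N, T₀ = H + 1 + (N + 1) := ⟨T₀ - H - 2, by omega⟩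
    have b1 : η * H ≤ η * m * H ^ 2 := by
      have : η * H * (1 * 1) ≤ η * H * (m * H) := by gcongr
      linarith
    have b2 : m * H * η ≤ η * m * H ^ 2 := by
      have : η * m * H * 1 ≤ η * m * H * H := by gcongr
      linarith
    have hηle : η ≤ 1 / 4 := by
      have : η * 1 ≤ η * H := by gcongr
      linarith
    have key := sum_variance_fwdDiff_le_half (p := fun s => optHedgeIter η (l i) (H + s + 1 + 1))
      (v := fun s => l i (H + s + 1)) (N := N + 1) hH (by omega) (by omega)
      (by positivity : 0 ≤ 8 * η) (by linarith) (fun s => h0 _) (fun s => h1 _)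
      (fun s => by
        have := ratioClose_optHedgeIter (hn i) hη.le hηle hI (H + s + 1)
        simpa only [← add_assoc] using this)
      (by positivity : 0 ≤ 72 * η * m * H ^ 2) (by linarith)
      (fun h hh s j => by
        have := hl.abs_fwdDiff_iter_le hn hm hH hη (by linarith) h hh i j (H + s) (by omega)
        have hs := fwdDiff_iter_comp_add 1 (fun t => l i t j) (H + 1) h s
        rw [fwdDiff_iter_apply_apply]
        simp only [show ∀ t, H + t + 1 = t + (H + 1) by intro t; ring] at this ⊢
        rw [hs]
        exact this)
    rw [Nat.add_sub_cancel] at key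
    have c1 : ∀ s, variance (optHedgeIter η (l i) (H + s + 1 + 1))
        (fwdDiff 1 (fun s => l i (H + s + 1)) s) = F (H + 1 + s) := fun s => by
      rw [hF, show H + 1 + s = H + s + 1 by ring]
      rfl
    have c2 : ∀ s, variance (optHedgeIter η (l i) (H + s + 1 + 1)) (l i (H + s + 1)) =
        S (H + 1 + s) := fun s => by
      rw [hS, show H + 1 + s = H + s + 1 by ring]
    simp only [c1, c2] at key
    rw [sum_range_add F, sum_range_add S, sum_range_succ _ N]
    have d1 := hFN (H + 1)
    have d2 := hF1 (H + 1 + N)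
    have d3 : 0 ≤ ∑ s ∈ range (H + 1), S s := sum_nonneg fun s _ => hS0 s
    push_cast at d1
    linarith

end Variation

/-! ### Regret bounds for Optimistic Hedge -/

section Regret

variable {n : ℕ}

/-- The centered cumulant generating function. -/
noncomputable def centeredCgf (P v : Fin n → ℝ) : ℝ :=
  Real.log (∑ j, P j * Real.exp (v j)) - ∑ j, P j * v j

/-! ### Second-order estimates of the centered cumulant generating function -/

section Cgf

variable {P v : Fin n → ℝ}

theorem sum_mul_exp_pos (hP : ∀ j, 0 ≤ P j) (hP1 : ∑ j, P j = 1) (v : Fin n → ℝ) :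
    0 < ∑ j, P j * Real.exp (v j) := by
  obtain ⟨j, -, hj⟩ : ∃ j ∈ univ, 0 < P j := by
    by_contra! h
    have := sum_nonpos h
    linarith
  exact sum_pos' (fun j _ => mul_nonneg (hP j) (Real.exp_pos _).le)
    ⟨j, mem_univ j, mul_pos hj (Real.exp_pos _)⟩

theorem centeredCgf_eq (hP : ∀ j, 0 ≤ P j) (hP1 : ∑ j, P j = 1) (v : Fin n → ℝ) :
    centeredCgf P v = Real.log (∑ j, P j * Real.exp (v j - ∑ k, P k * v k)) := by
  have h : ∑ j, P j * Real.exp (v j - ∑ k, P k * v k) =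
      (∑ j, P j * Real.exp (v j)) * Real.exp (-∑ k, P k * v k) := by
    simp only [sub_eq_add_neg, Real.exp_add, ← mul_assoc, ← sum_mul]
  rw [h, Real.log_mul (sum_mul_exp_pos hP hP1 v).ne' (Real.exp_pos _).ne', Real.log_exp,
    centeredCgf, sub_eq_add_neg]

theorem sum_mul_sub_mean (hP1 : ∑ j, P j = 1) (v : Fin n → ℝ) :
    ∑ j, P j * (v j - ∑ k, P k * v k) = 0 := by
  simp only [mul_sub, sum_sub_distrib, ← sum_mul, hP1, one_mul, sub_self]

theorem sum_mul_quadratic (hP1 : ∑ j, P j = 1) (v : Fin n → ℝ) (c : ℝ) :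
    ∑ j, P j * (1 + (v j - ∑ k, P k * v k) + c * (v j - ∑ k, P k * v k) ^ 2) =
      1 + c * variance P v := by
  have : ∀ j, P j * (1 + (v j - ∑ k, P k * v k) + c * (v j - ∑ k, P k * v k) ^ 2) =
      P j + P j * (v j - ∑ k, P k * v k) + c * (P j * (v j - ∑ k, P k * v k) ^ 2) :=
    fun j => by ring
  simp only [this, sum_add_distrib, ← mul_sum, hP1, sum_mul_sub_mean hP1, add_zero, variance]

theorem abs_sub_mean_le (hP : ∀ j, 0 ≤ P j) (hP1 : ∑ j, P j = 1) {a : ℝ} (hv : ∀ j, |v j| ≤ a)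
    (j : Fin n) : |v j - ∑ k, P k * v k| ≤ 2 * a := by
  have h : |∑ k, P k * v k| ≤ a := by
    calc _ ≤ ∑ k, P k * a := (abs_sum_le_sum_abs _ _).trans (sum_le_sum fun k _ => by
          rw [abs_mul, abs_of_nonneg (hP k)]
          exact mul_le_mul_of_nonneg_left (hv k) (hP k))
      _ = a := by rw [← sum_mul, hP1, one_mul]
  linarith [abs_sub (v j) (∑ k, P k * v k), hv j]

theorem centeredCgf_le_of_exp_le (hP : ∀ j, 0 ≤ P j) (hP1 : ∑ j, P j = 1) {c : ℝ}
    (h : ∀ j, Real.exp (v j - ∑ k, P k * v k) ≤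
      1 + (v j - ∑ k, P k * v k) + c * (v j - ∑ k, P k * v k) ^ 2) :
    centeredCgf P v ≤ c * variance P v := by
  rw [centeredCgf_eq hP hP1]
  have h1 := sum_le_sum fun j (_ : j ∈ univ) => mul_le_mul_of_nonneg_left (h j) (hP j)
  rw [sum_mul_quadratic hP1] at h1
  have h2 := Real.log_le_sub_one_of_pos (sum_mul_exp_pos hP hP1 fun j => v j - ∑ k, P k * v k)
  linarith

theorem centeredCgf_nonneg (hP : ∀ j, 0 ≤ P j) (hP1 : ∑ j, P j = 1) (v : Fin n → ℝ) :
    0 ≤ centeredCgf P v := by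
  rw [centeredCgf_eq hP hP1]
  refine Real.log_nonneg ?_
  have h1 := sum_le_sum fun j (_ : j ∈ univ) => mul_le_mul_of_nonneg_left
    (Real.add_one_le_exp (v j - ∑ k, P k * v k)) (hP j)
  simp only [mul_add, sum_add_distrib, mul_one, hP1, sum_mul_sub_mean hP1] at h1
  linarith

theorem centeredCgf_le_sq (hP : ∀ j, 0 ≤ P j) (hP1 : ∑ j, P j = 1) {a : ℝ} (ha : a ≤ 1 / 2)
    (hv : ∀ j, |v j| ≤ a) : centeredCgf P v ≤ a ^ 2 := by
  refine (centeredCgf_le_of_exp_le hP hP1 (c := 1) fun j => ?_).trans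
    (by simpa using variance_le_sq hP hP1 hv)
  have := (abs_le.1 (Real.abs_exp_sub_one_sub_id_le
    ((abs_sub_mean_le hP hP1 hv j).trans (by linarith)))).2
  linarith

theorem abs_exp_sub_quadratic_le {u : ℝ} (hu : |u| ≤ 1 / 10) :
    |Real.exp u - (1 + u + 1 / 2 * u ^ 2)| ≤ 3 / 100 * u ^ 2 := by
  have h := Real.exp_bound (hu.trans (by norm_num)) (n := 3) (by norm_num)
  simp only [sum_range_succ, range_zero, sum_empty, Nat.factorial] at h
  norm_num at h
  rw [show 1 + u + u ^ 2 / 2 = 1 + u + 1 / 2 * u ^ 2 by ring] at h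
  refine h.trans ?_
  have h3 : |u| ^ 3 = |u| * u ^ 2 := by rw [← sq_abs u]; ring
  rw [h3]
  have := mul_le_mul_of_nonneg_right hu (sq_nonneg u)
  linarith [sq_nonneg u]

theorem centeredCgf_le_variance (hP : ∀ j, 0 ≤ P j) (hP1 : ∑ j, P j = 1)
    (hv : ∀ j, |v j| ≤ 1 / 20) : centeredCgf P v ≤ 6 / 10 * variance P v := by
  refine centeredCgf_le_of_exp_le hP hP1 fun j => ?_
  have := (abs_le.1 (abs_exp_sub_quadratic_le
    ((abs_sub_mean_le hP hP1 hv j).trans (by norm_num)))).2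
  linarith [sq_nonneg (v j - ∑ k, P k * v k)]

/-- This gives the negative term of the regret bound. It uses `log y ≥ 1 - 1/y` with `y ≥ 1 + 0.47
V`; as `V ≤ 1/400`, little of `0.47` is lost. -/
theorem le_centeredCgf (hP : ∀ j, 0 ≤ P j) (hP1 : ∑ j, P j = 1)
    (hv : ∀ j, |v j| ≤ 1 / 20) : 4 / 10 * variance P v ≤ centeredCgf P v := by
  rw [centeredCgf_eq hP hP1]
  have hV0 := variance_nonneg hP v
  have hV1 := variance_le_sq hP hP1 hv
  have hy := sum_mul_exp_pos hP hP1 fun j => v j - ∑ k, P k * v k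
  have h1 : 1 + 47 / 100 * variance P v ≤ ∑ j, P j * Real.exp (v j - ∑ k, P k * v k) := by
    rw [← sum_mul_quadratic hP1]
    refine sum_le_sum fun j _ => mul_le_mul_of_nonneg_left ?_ (hP j)
    have := (abs_le.1 (abs_exp_sub_quadratic_le
      ((abs_sub_mean_le hP hP1 hv j).trans (by norm_num)))).1
    linarith
  refine le_trans ?_ (Real.one_sub_inv_le_log_of_pos hy)
  have h2 := inv_anti₀ (by positivity) h1
  have h3 : (1 + 47 / 100 * variance P v)⁻¹ ≤ 1 - 4 / 10 * variance P v := by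
    rw [inv_le_iff_one_le_mul₀ (by positivity)]
    nlinarith
  linarith

end Cgf

theorem variance_const_mul (P v : Fin n → ℝ) (c : ℝ) :
    variance P (fun j => c * v j) = c ^ 2 * variance P v := by
  rw [variance, variance, mul_sum]
  refine sum_congr rfl fun j _ => ?_
  have : ∑ k, P k * (c * v k) = c * ∑ k, P k * v k := by
    rw [mul_sum]; exact sum_congr rfl fun k _ => by ring
  rw [this]; ring

/-- The increments `2ℓᵗ - ℓᵗ⁻¹` telescope to the cumulative loss plus one extra copy of the last
loss, the prediction for the next round. -/
theorem logWeight_zero_eq (η : ℝ) {l : ℕ → Fin n → ℝ} (hl0 : l 0 = 0) (j : Fin n) (s : ℕ) :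
    logWeight η l 0 j s = -η * (∑ r ∈ range s, l (r + 1) j + l s j) := by
  induction s with
  | zero => simp [logWeight, hl0]
  | succ s ih =>
    have : logWeight η l 0 j (s + 1) =
        logWeight η l 0 j s + -η * (2 * l (s + 1) j - l s j) := by
      rw [logWeight, sum_range_succ, zero_add]; rfl
    rw [this, ih, sum_range_succ]
    ring

/-- The regret of Optimistic Hedge in terms of cumulant generating functions. -/
theorem mul_regret_le_sum_centeredCgf (hn : 0 < n) (η : ℝ) {l : ℕ → Fin n → ℝ} (hl0 : l 0 = 0)
    (T : ℕ) (j : Fin n) :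
    η * (∑ t ∈ Icc 1 T, ∑ k, optHedgeIter η l t k * l t k - ∑ t ∈ Icc 1 T, l t j) ≤
      Real.log n + ∑ s ∈ range T,
        (centeredCgf (optHedgeIter η l (s + 1)) (fun k => -η * (l (s + 1) k - l s k)) -
          centeredCgf (optHedgeIter η l (s + 1)) (fun k => η * l s k)) := by
  have : Nonempty (Fin n) := ⟨j⟩
  have hn' : (0 : ℝ) < n := by exact_mod_cast hn
  rw [sum_Icc_one_eq_sum_range, sum_Icc_one_eq_sum_range]
  set L : ℕ → Fin n → ℝ := fun s k => ∑ r ∈ range s, l (r + 1) k with hL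
  set Ψ : ℕ → ℝ := fun s => Real.log (∑ k, 1 / (n : ℝ) * Real.exp (-η * L s k)) with hΨ
  have hpos : ∀ w : Fin n → ℝ, 0 < ∑ k, 1 / (n : ℝ) * Real.exp (w k) := fun w =>
    sum_pos (fun k _ => by positivity) univ_nonempty
  -- Moment generating functions under the iterate are differences of log-partition functions, since
  -- the iterate is proportional to `exp (-η (L s + l s))`.
  have hmgf : ∀ s (w : Fin n → ℝ), Real.log (∑ k, optHedgeIter η l (s + 1) k * Real.exp (w k)) =
      Real.log (∑ k, 1 / (n : ℝ) * Real.exp (-η * (L s k + l s k) + w k)) -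
        Real.log (∑ k, 1 / (n : ℝ) * Real.exp (-η * (L s k + l s k))) := by
    intro s w
    rw [← Real.log_div (hpos _).ne' (hpos _).ne', sum_div]
    refine congrArg Real.log (sum_congr rfl fun k _ => ?_)
    have h1 := optHedgeIter_eq_softmax hn η l 0 s k
    simp only [logWeight_zero_eq η hl0] at h1
    rw [show s + 1 = 0 + 1 + s by ring, h1, Real.exp_add]
    simp only [optHedgeIter]
    ring
  -- Both potentials are seen from the same iterate: `w = -η(ℓˢ⁺¹ - ℓˢ)` reaches `Ψ (s + 1)` and `w
  -- = ηℓˢ` reaches `Ψ s`. The means combine to the loss of the round.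
  have hstep : ∀ s, Ψ (s + 1) - Ψ s =
      centeredCgf (optHedgeIter η l (s + 1)) (fun k => -η * (l (s + 1) k - l s k)) -
        centeredCgf (optHedgeIter η l (s + 1)) (fun k => η * l s k) -
        η * ∑ k, optHedgeIter η l (s + 1) k * l (s + 1) k := by
    intro s
    have e1 : ∀ k, -η * (L s k + l s k) + -η * (l (s + 1) k - l s k) = -η * L (s + 1) k := by
      intro k
      simp only [hL]
      rw [sum_range_succ]; ring
    have e2 : ∀ k, -η * (L s k + l s k) + η * l s k = -η * L s k := fun k => by ring
    have e3 : ∑ k, optHedgeIter η l (s + 1) k * (-η * (l (s + 1) k - l s k)) =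
        -(η * ∑ k, optHedgeIter η l (s + 1) k * l (s + 1) k) +
          ∑ k, optHedgeIter η l (s + 1) k * (η * l s k) := by
      rw [mul_sum, ← sum_neg_distrib, ← sum_add_distrib]
      exact sum_congr rfl fun k _ => by ring
    rw [centeredCgf, centeredCgf, hmgf, hmgf, e3]
    simp only [e1, e2, hΨ]
    ring
  have htel : Ψ T - Ψ 0 = _ := (sum_range_sub Ψ T).symm
  simp only [hstep] at htel
  have h0 : Ψ 0 = 0 := by simp [hΨ, hL, hn'.ne']
  have hT : -Real.log n - η * L T j ≤ Ψ T := by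
    have h2 : 1 / (n : ℝ) * Real.exp (-η * L T j) ≤ ∑ k, 1 / (n : ℝ) * Real.exp (-η * L T k) :=
      single_le_sum (f := fun k => 1 / (n : ℝ) * Real.exp (-η * L T k))
        (fun k _ => by positivity) (mem_univ j)
    have h3 := Real.log_le_log (by positivity) h2
    have h4 : Real.log (1 / (n : ℝ)) = -Real.log n := by rw [one_div, Real.log_inv]
    rw [Real.log_mul (by positivity) (Real.exp_pos _).ne', Real.log_exp, h4] at h3
    have h5 : Ψ T = Real.log (∑ k, 1 / (n : ℝ) * Real.exp (-η * L T k)) := rfl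
    linarith
  rw [sum_sub_distrib, ← mul_sum, h0] at htel
  rw [mul_sub]
  linarith

/-- Regret of Optimistic Hedge with a small step size, when the variation of the losses is at most
half their second order moment plus `B`. -/
theorem regret_le_of_variation_le (hn : 0 < n) {η : ℝ} (hη : 0 < η) (hη1 : η ≤ 1 / 20)
    {l : ℕ → Fin n → ℝ} (hl0 : l 0 = 0) {T : ℕ}
    (hl : ∀ t ≤ T, ∀ j, l t j ∈ Set.Icc (0 : ℝ) 1) {B : ℝ} (hB0 : 0 ≤ B)
    (hB : ∑ t ∈ Icc 1 T, variance (optHedgeIter η l t) (l t - l (t - 1)) ≤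
      (1 / 2) * ∑ t ∈ Icc 1 T, variance (optHedgeIter η l t) (l (t - 1)) + B) (j : Fin n) :
    ∑ t ∈ Icc 1 T, ∑ k, optHedgeIter η l t k * l t k - ∑ t ∈ Icc 1 T, l t j ≤
      Real.log n / η + η * B := by
  have h0 : ∀ t k, 0 ≤ optHedgeIter η l t k := fun t k => (optHedgeIter_pos hn _ _ _ _).le
  have h1 : ∀ t, ∑ k, optHedgeIter η l t k = 1 := fun t => sum_optHedgeIter hn _ _ _
  have key := mul_regret_le_sum_centeredCgf hn η hl0 T j
  rw [sum_Icc_one_eq_sum_range (fun t => variance (optHedgeIter η l t) (l t - l (t - 1))),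
    sum_Icc_one_eq_sum_range (fun t => variance (optHedgeIter η l t) (l (t - 1)))] at hB
  simp only [Nat.add_sub_cancel] at hB
  have hterm : ∀ s ∈ range T,
      centeredCgf (optHedgeIter η l (s + 1)) (fun k => -η * (l (s + 1) k - l s k)) -
        centeredCgf (optHedgeIter η l (s + 1)) (fun k => η * l s k) ≤
      6 / 10 * η ^ 2 * variance (optHedgeIter η l (s + 1)) (l (s + 1) - l s) -
        4 / 10 * η ^ 2 * variance (optHedgeIter η l (s + 1)) (l s) := by
    intro s hs
    have hs' := mem_range.1 hs
    have a1 := centeredCgf_le_variance (h0 (s + 1)) (h1 (s + 1))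
      (v := fun k => -η * (l (s + 1) k - l s k)) fun k => by
        have b1 := hl (s + 1) (by omega) k
        have b2 := hl s (by omega) k
        rw [abs_mul, abs_neg, abs_of_pos hη]
        have : |l (s + 1) k - l s k| ≤ 1 := by
          rw [abs_le]
          constructor <;> linarith [b1.1, b1.2, b2.1, b2.2]
        nlinarith
    have a2 := le_centeredCgf (h0 (s + 1)) (h1 (s + 1)) (v := fun k => η * l s k) fun k => by
      have b2 := hl s (by omega) k
      rw [abs_of_nonneg (mul_nonneg hη.le b2.1)]
      nlinarith [b2.2]
    rw [variance_const_mul] at a2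
    rw [variance_const_mul _ (fun k => l (s + 1) k - l s k)] at a1
    have e : (fun k => l (s + 1) k - l s k) = l (s + 1) - l s := rfl
    rw [e, neg_sq] at a1
    linarith
  have hsum := sum_le_sum hterm
  have hsub : ∑ s ∈ range T,
      (6 / 10 * η ^ 2 * variance (optHedgeIter η l (s + 1)) (l (s + 1) - l s) -
        4 / 10 * η ^ 2 * variance (optHedgeIter η l (s + 1)) (l s)) =
      6 / 10 * η ^ 2 * ∑ s ∈ range T, variance (optHedgeIter η l (s + 1)) (l (s + 1) - l s) -
        4 / 10 * η ^ 2 * ∑ s ∈ range T, variance (optHedgeIter η l (s + 1)) (l s) := by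
    rw [sum_sub_distrib, ← mul_sum, ← mul_sum]
  rw [hsub] at hsum
  have hV0 : 0 ≤ ∑ s ∈ range T, variance (optHedgeIter η l (s + 1)) (l s) :=
    sum_nonneg fun s _ => variance_nonneg (h0 _) _
  have hD0 : 0 ≤ ∑ s ∈ range T, variance (optHedgeIter η l (s + 1)) (l (s + 1) - l s) :=
    sum_nonneg fun s _ => variance_nonneg (h0 _) _
  generalize ∑ s ∈ range T, variance (optHedgeIter η l (s + 1)) (l s) = V at *
  generalize ∑ s ∈ range T, variance (optHedgeIter η l (s + 1)) (l (s + 1) - l s) = D at *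
  -- With `D ≤ V/2 + B` the positive part is at most `0.3 V + 0.6 B`, so the `0.4 V` earned back
  -- covers it up to `B`.
  have hcomb : 6 / 10 * η ^ 2 * D - 4 / 10 * η ^ 2 * V ≤ η ^ 2 * B := by
    have : 6 / 10 * D - 4 / 10 * V ≤ B := by linarith
    have := mul_le_mul_of_nonneg_left this (sq_nonneg η)
    linarith
  refine le_of_mul_le_mul_left ?_ hη
  rw [mul_add, mul_div_cancel₀ _ hη.ne']
  linarith

/-- Regret of Optimistic Hedge against arbitrary losses. -/
theorem regret_le_adversarial (hn : 0 < n) {η : ℝ} (hη : 0 < η) (hη1 : η ≤ 1 / 2)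
    {l : ℕ → Fin n → ℝ} (hl0 : l 0 = 0) {T : ℕ}
    (hl : ∀ t ≤ T, ∀ j, l t j ∈ Set.Icc (0 : ℝ) 1) (j : Fin n) :
    ∑ t ∈ Icc 1 T, ∑ k, optHedgeIter η l t k * l t k - ∑ t ∈ Icc 1 T, l t j ≤
      Real.log n / η + η * T := by
  have h0 : ∀ t k, 0 ≤ optHedgeIter η l t k := fun t k => (optHedgeIter_pos hn _ _ _ _).le
  have h1 : ∀ t, ∑ k, optHedgeIter η l t k = 1 := fun t => sum_optHedgeIter hn _ _ _
  have key := mul_regret_le_sum_centeredCgf hn η hl0 T j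
  have hterm : ∀ s ∈ range T,
      centeredCgf (optHedgeIter η l (s + 1)) (fun k => -η * (l (s + 1) k - l s k)) -
        centeredCgf (optHedgeIter η l (s + 1)) (fun k => η * l s k) ≤ η ^ 2 := by
    intro s hs
    have hs' := mem_range.1 hs
    have a1 := centeredCgf_le_sq (h0 (s + 1)) (h1 (s + 1)) hη1
      (v := fun k => -η * (l (s + 1) k - l s k)) fun k => by
        have b1 := hl (s + 1) (by omega) k
        have b2 := hl s (by omega) k
        rw [abs_mul, abs_neg, abs_of_pos hη]
        refine mul_le_of_le_one_right hη.le ?_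
        rw [abs_le]
        constructor <;> linarith [b1.1, b1.2, b2.1, b2.2]
    have a2 := centeredCgf_nonneg (h0 (s + 1)) (h1 (s + 1)) fun k => η * l s k
    linarith
  have hsum := sum_le_sum hterm
  rw [sum_const, card_range, nsmul_eq_mul] at hsum
  refine le_of_mul_le_mul_left ?_ hη
  rw [mul_add, mul_div_cancel₀ _ hη.ne']
  linarith

end Regret

/-! ### The algorithm with a switch -/

section Switch

variable {n : ℕ}

/-- Causality: later losses are never read, so the default `0` beyond the end of a history is
harmless. -/
theorem optHedgeIter_congr (η : ℝ) {l l' : ℕ → Fin n → ℝ} (t : ℕ) (h : ∀ s < t, l s = l' s) :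
    optHedgeIter η l t = optHedgeIter η l' t := by
  induction t with
  | zero => rfl
  | succ t ih =>
    cases t with
    | zero => rfl
    | succ t =>
      funext j
      simp only [optHedgeIter]
      rw [ih fun s hs => h s (by omega), h (t + 1) (by omega), h t (by omega)]

theorem switchTest_congr {C' η : ℝ} {T T₀ : ℕ} {l l' : ℕ → Fin n → ℝ}
    (h : ∀ s ≤ T₀, l s = l' s) : SwitchTest C' η T l T₀ ↔ SwitchTest C' η T l' T₀ := by
  have hx : ∀ t ∈ Icc 1 T₀, optHedgeIter η l t = optHedgeIter η l' t := fun t ht =>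
    optHedgeIter_congr η t fun s hs => h s (by have := (mem_Icc.1 ht).2; omega)
  have h1 : ∑ t ∈ Icc 1 T₀, variance (optHedgeIter η l t) (l (t - 1)) =
      ∑ t ∈ Icc 1 T₀, variance (optHedgeIter η l' t) (l' (t - 1)) :=
    sum_congr rfl fun t ht => by
      rw [hx t ht, h (t - 1) (by have := (mem_Icc.1 ht).2; omega)]
  have h2 : ∑ t ∈ Icc 1 T₀, variance (optHedgeIter η l t) (l t - l (t - 1)) =
      ∑ t ∈ Icc 1 T₀, variance (optHedgeIter η l' t) (l' t - l' (t - 1)) :=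
    sum_congr rfl fun t ht => by
      rw [hx t ht, h (t - 1) (by have := (mem_Icc.1 ht).2; omega), h t (mem_Icc.1 ht).2]
  rw [SwitchTest, SwitchTest, h1, h2]

/-- The history after `t` rounds with losses `l`. -/
def lossHistory (l : ℕ → Fin n → ℝ) (t : ℕ) : List (Fin n → ℝ) :=
  (List.range t).map fun s => l (s + 1)

theorem length_lossHistory (l : ℕ → Fin n → ℝ) (t : ℕ) : (lossHistory l t).length = t := by
  simp [lossHistory]

theorem lossAt_lossHistory {l : ℕ → Fin n → ℝ} (hl0 : l 0 = 0) {t s : ℕ} (hs : s ≤ t) :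
    lossAt (lossHistory l t) s = l s := by
  cases s with
  | zero => exact hl0.symm
  | succ s => simp [lossAt, lossHistory, List.getD_eq_getElem?_getD, show s < t by omega]

theorem drop_lossHistory (l : ℕ → Fin n → ℝ) (T₀ t : ℕ) :
    (lossHistory l (T₀ + t)).drop T₀ = lossHistory (fun s => l (T₀ + s)) t := by
  refine List.ext_getElem? fun k => ?_
  simp only [lossHistory, List.getElem?_drop, List.getElem?_map]
  by_cases hk : k < t
  · simp [hk, add_assoc]
  · simp [hk]

theorem optHedge_lossHistory (η : ℝ) {l : ℕ → Fin n → ℝ} (hl0 : l 0 = 0) (t : ℕ) :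
    optHedge η (lossHistory l t) = optHedgeIter η l (t + 1) := by
  rw [optHedge, length_lossHistory]
  exact optHedgeIter_congr η _ fun s hs => lossAt_lossHistory hl0 (by omega)

variable {C C' : ℝ} {m T : ℕ} {l : ℕ → Fin n → ℝ}

theorem switchedOptHedge_of_forall_not (hl0 : l 0 = 0) {t : ℕ}
    (h : ∀ T₀ ≤ t, ¬SwitchTest C' (1 / (C * m * Real.logb 2 T ^ 4)) T l T₀) :
    switchedOptHedge C C' m T n (lossHistory l t) =
      optHedgeIter (1 / (C * m * Real.logb 2 T ^ 4)) l (t + 1) := by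
  rw [switchedOptHedge]
  rw [dif_neg, optHedge_lossHistory _ hl0]
  rintro ⟨T₀, hT₀, hs⟩
  rw [length_lossHistory] at hT₀
  exact h T₀ hT₀ ((switchTest_congr fun s hs => lossAt_lossHistory hl0 (by omega)).1 hs)

theorem switchedOptHedge_of_switchTest (hl0 : l 0 = 0) {T₀ : ℕ}
    (h : ∀ T₁ < T₀, ¬SwitchTest C' (1 / (C * m * Real.logb 2 T ^ 4)) T l T₁)
    (hT₀ : SwitchTest C' (1 / (C * m * Real.logb 2 T ^ 4)) T l T₀) (t : ℕ) :
    switchedOptHedge C C' m T n (lossHistory l (T₀ + t)) =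
      optHedgeIter √(Real.logb 2 n / T) (fun s => if s = 0 then 0 else l (T₀ + s)) (t + 1) := by
  have hiff : ∀ T₁ ≤ T₀ + t,
      (SwitchTest C' (1 / (C * m * Real.logb 2 T ^ 4)) T (lossAt (lossHistory l (T₀ + t))) T₁ ↔
        SwitchTest C' (1 / (C * m * Real.logb 2 T ^ 4)) T l T₁) := fun T₁ h₁ =>
    switchTest_congr fun s hs => lossAt_lossHistory hl0 (by omega)
  have hs : ∃ T₁, T₁ ≤ (lossHistory l (T₀ + t)).length ∧
      SwitchTest C' (1 / (C * m * Real.logb 2 T ^ 4)) T (lossAt (lossHistory l (T₀ + t))) T₁ :=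
    ⟨T₀, by rw [length_lossHistory]; omega, (hiff T₀ (by omega)).2 hT₀⟩
  classical
  have hfind : Nat.find hs = T₀ := by
    refine (Nat.find_eq_iff hs).2 ⟨⟨by rw [length_lossHistory]; omega,
      (hiff T₀ (by omega)).2 hT₀⟩, fun T₁ h₁ hT₁ => h T₁ h₁ ((hiff T₁ (by omega)).1 hT₁.2)⟩
  rw [switchedOptHedge]
  rw [dif_pos hs]
  -- The restarted run must see `ℓ⁰ = 0` although `l T₀` need not vanish; histories do not read
  -- index `0`.
  have hshift : lossHistory (fun s => l (T₀ + s)) t =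
      lossHistory (fun s => if s = 0 then 0 else l (T₀ + s)) t := by
    simp [lossHistory]
  rw [← optHedge_lossHistory _ (by simp), ← hshift, ← drop_lossHistory]
  congr 2

end Switch

/-! ### Regret within each phase -/

section RegretBounds

variable {n : ℕ}

theorem regret_le_of_forall (hn : 0 < n) {x l : ℕ → Fin n → ℝ} {T : ℕ} {R : ℝ}
    (h : ∀ j, ∑ t ∈ Icc 1 T, ∑ k, x t k * l t k - ∑ t ∈ Icc 1 T, l t j ≤ R) :
    regret x l T ≤ R := by
  have : Nonempty (Fin n) := ⟨⟨0, hn⟩⟩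
  obtain ⟨j, hj⟩ := exists_eq_ciInf_of_finite (f := fun j => ∑ t ∈ Icc 1 T, l t j)
  rw [regret, ← hj]
  exact h j

/-- For one action the target bound is `0` because `log 1 = 0`, so the additive constants of the
general estimates could not be absorbed. -/
theorem regret_le_zero_of_eq_one (hn : n = 1) {x : ℕ → Fin n → ℝ} (hx : ∀ t, ∑ k, x t k = 1)
    (l : ℕ → Fin n → ℝ) (T : ℕ) : regret x l T ≤ 0 := by
  refine regret_le_of_forall (by omega) fun j => ?_
  subst hn
  have h : ∀ t, x t 0 = 1 := fun t => by simpa using hx t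
  simp [h, Subsingleton.elim j 0]

theorem regret_le_card {x l : ℕ → Fin n → ℝ} (hx : ∀ t k, 0 ≤ x t k)
    (hx1 : ∀ t, ∑ k, x t k = 1) {T : ℕ} (hl : ∀ t ≤ T, ∀ j, l t j ∈ Set.Icc (0 : ℝ) 1)
    (j : Fin n) :
    ∑ t ∈ Icc 1 T, ∑ k, x t k * l t k - ∑ t ∈ Icc 1 T, l t j ≤ T := by
  have h1 : ∑ t ∈ Icc 1 T, ∑ k, x t k * l t k ≤ ∑ t ∈ Icc 1 T, 1 := by
    refine sum_le_sum fun t ht => ?_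
    rw [← hx1 t]
    exact sum_le_sum fun k _ => mul_le_of_le_one_right (hx t k) (hl t (mem_Icc.1 ht).2 k).2
  have h2 : 0 ≤ ∑ t ∈ Icc 1 T, l t j := sum_nonneg fun t ht => (hl t (mem_Icc.1 ht).2 j).1
  simp only [sum_const, Nat.card_Icc, nsmul_eq_mul, mul_one, Nat.add_sub_cancel] at h1
  linarith

/-- Regret of Optimistic Hedge up to the first success of the switching test. -/
theorem regret_le_of_not_switchTest (hn : 0 < n) {C' η : ℝ} (hC' : 0 ≤ C') (hη : 0 < η)
    (hη1 : η ≤ 1 / 20) {l : ℕ → Fin n → ℝ} (hl0 : l 0 = 0) {T N : ℕ}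
    (hl : ∀ t ≤ N, ∀ j, l t j ∈ Set.Icc (0 : ℝ) 1)
    (h : ∀ T₀ < N, ¬SwitchTest C' η T l T₀) (j : Fin n) :
    ∑ t ∈ Icc 1 N, ∑ k, optHedgeIter η l t k * l t k - ∑ t ∈ Icc 1 N, l t j ≤
      Real.log n / η + η * (C' * (⌈Real.logb 2 T⌉₊ : ℝ) ^ 5) + 4 := by
  have h0 : ∀ t k, 0 ≤ optHedgeIter η l t k := fun t k => (optHedgeIter_pos hn _ _ _ _).le
  have h1 : ∀ t, ∑ k, optHedgeIter η l t k = 1 := fun t => sum_optHedgeIter hn _ _ _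
  have hlog : 0 ≤ Real.log n / η :=
    div_nonneg (Real.log_nonneg (by exact_mod_cast hn)) hη.le
  have hB : 0 ≤ C' * (⌈Real.logb 2 T⌉₊ : ℝ) ^ 5 := by positivity
  -- The test is only defined from round `4` on, so up to four rounds are bounded trivially. For
  -- longer phases the test at `N - 1` failed, and round `N` costs at most `1`.
  rcases le_or_gt N 4 with hN | hN
  · have h2 := regret_le_card h0 h1 hl j
    have h3 : (N : ℝ) ≤ 4 := by exact_mod_cast hN
    have h4 := mul_nonneg hη.le hB
    linarith
  · obtain ⟨N, rfl⟩ : ∃ M, N = M + 1 := ⟨N - 1, by omega⟩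
    have htest := h N (by omega)
    rw [SwitchTest, not_and, not_lt] at htest
    have h2 := regret_le_of_variation_le hn hη hη1 hl0 (T := N)
      (fun t ht => hl t (by omega)) hB (htest (by omega)) j
    rw [sum_Icc_succ_top (by omega), sum_Icc_succ_top (by omega)]
    have h3 : ∑ k, optHedgeIter η l (N + 1) k * l (N + 1) k ≤ 1 := by
      rw [← h1 (N + 1)]
      exact sum_le_sum fun k _ => mul_le_of_le_one_right (h0 _ k) (hl _ le_rfl k).2
    have h4 := (hl (N + 1) le_rfl j).1
    linarith

theorem log_le_logb_two {n : ℕ} (hn : 0 < n) : Real.log n ≤ Real.logb 2 n := by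
  rw [Real.logb, le_div_iff₀ (Real.log_pos (by norm_num))]
  have h0 : 0 ≤ Real.log n := Real.log_nonneg (by exact_mod_cast hn)
  exact mul_le_of_le_one_right h0 (by linarith [Real.log_two_lt_d9])

/-- Regret of Optimistic Hedge with step size `√(log₂ n / T)` over at most `T` rounds. -/
theorem regret_le_sqrt (hn : 2 ≤ n) {l : ℕ → Fin n → ℝ} (hl0 : l 0 = 0) {T N : ℕ} (hT : 0 < T)
    (hNT : N ≤ T) (hl : ∀ t ≤ N, ∀ j, l t j ∈ Set.Icc (0 : ℝ) 1) (j : Fin n) :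
    ∑ t ∈ Icc 1 N, ∑ k, optHedgeIter √(Real.logb 2 n / T) l t k * l t k -
      ∑ t ∈ Icc 1 N, l t j ≤ 2 * √(T * Real.logb 2 n) := by
  have hT' : (0 : ℝ) < T := by exact_mod_cast hT
  have hNT' : (N : ℝ) ≤ T := by exact_mod_cast hNT
  have hlog : 0 < Real.logb 2 n :=
    Real.logb_pos (by norm_num) (by exact_mod_cast (by omega : 1 < n))
  have hη : √(Real.logb 2 n / T) = √(T * Real.logb 2 n) / T := by
    rw [show Real.logb 2 n / T = T * Real.logb 2 n / T ^ 2 by field_simp,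
      Real.sqrt_div (by positivity), Real.sqrt_sq hT'.le]
  have hS : 0 < √(T * Real.logb 2 n) := Real.sqrt_pos.2 (by positivity)
  have hSS : √(T * Real.logb 2 n) * √(T * Real.logb 2 n) = T * Real.logb 2 n :=
    Real.mul_self_sqrt (by positivity)
  rw [hη]
  generalize √(T * Real.logb 2 n) = S at *
  have hη0 : 0 < S / T := by positivity
  -- If the step size exceeds `1/2`, then `T < 2S` and the trivial bound `N ≤ T` is enough.
  rcases le_or_gt (S / T) (1 / 2) with hle | hgt
  · have h1 := regret_le_adversarial (by omega) hη0 hle hl0 hl j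
    have h2 : Real.log n / (S / T) ≤ S := by
      rw [div_le_iff₀ hη0, ← mul_div_assoc, hSS, mul_div_cancel_left₀ _ hT'.ne']
      exact log_le_logb_two (by omega)
    have h3 : S / T * N ≤ S := by
      calc S / T * N ≤ S / T * T := mul_le_mul_of_nonneg_left hNT' hη0.le
        _ = S := div_mul_cancel₀ _ hT'.ne'
    linarith
  · have h1 := regret_le_card (fun t k => (optHedgeIter_pos (by omega) (S / T) l t k).le)
      (fun t => sum_optHedgeIter (by omega) (S / T) l t) hl j
    rw [lt_div_iff₀ hT'] at hgt
    linarith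

end RegretBounds

/-! ### Choice of the constants -/

section StepSize

variable {m T : ℕ}

theorem one_le_logb_two {T : ℕ} (hT : 2 ≤ T) : 1 ≤ Real.logb 2 T := by
  rw [Real.le_logb_iff_rpow_le (by norm_num) (by exact_mod_cast (by omega : 0 < T)),
    Real.rpow_one]
  exact_mod_cast hT

theorem ceil_logb_le (hT : 2 ≤ T) : (⌈Real.logb 2 T⌉₊ : ℝ) ≤ 2 * Real.logb 2 T := by
  have h := one_le_logb_two hT
  linarith [Nat.ceil_lt_add_one (zero_le_one.trans h)]

theorem le_two_pow_ceil_logb (hT : 2 ≤ T) : T ≤ 2 ^ ⌈Real.logb 2 T⌉₊ := by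
  have hT' : (0 : ℝ) < T := by exact_mod_cast (by omega : 0 < T)
  have h : (T : ℝ) ≤ (2 : ℝ) ^ (⌈Real.logb 2 T⌉₊ : ℝ) :=
    (Real.logb_le_iff_le_rpow (by norm_num) hT').1 (Nat.le_ceil _)
  rw [Real.rpow_natCast] at h
  exact_mod_cast h

theorem stepSize_pos (hm : 1 ≤ m) (hT : 2 ≤ T) :
    0 < 1 / (2880 * (m : ℝ) * Real.logb 2 T ^ 4) := by
  have hm' : (1 : ℝ) ≤ m := by exact_mod_cast hm
  have h := one_le_logb_two hT
  positivity

/-- The condition of the variation bound; `⌈L⌉ ≤ 2L` yields `2880 = 720 * 4`. Only `L²` is needed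
here, and `L² ≤ L⁴`. -/
theorem stepSize_mul_le (hm : 1 ≤ m) (hT : 2 ≤ T) :
    720 * (1 / (2880 * (m : ℝ) * Real.logb 2 T ^ 4)) * m * (⌈Real.logb 2 T⌉₊ : ℝ) ^ 2 ≤ 1 := by
  have hm' : (1 : ℝ) ≤ m := by exact_mod_cast hm
  have h := one_le_logb_two hT
  have h2 := pow_le_pow_left₀ (by positivity) (ceil_logb_le hT) 2
  have h3 : Real.logb 2 T ^ 2 ≤ Real.logb 2 T ^ 4 := pow_le_pow_right₀ h (by norm_num)
  generalize Real.logb 2 T = L at *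
  rw [show 720 * (1 / (2880 * (m : ℝ) * L ^ 4)) * m * (⌈L⌉₊ : ℝ) ^ 2 =
    (⌈L⌉₊ : ℝ) ^ 2 / (4 * L ^ 4) by field_simp; ring, div_le_one (by positivity)]
  linarith

theorem stepSize_le (hm : 1 ≤ m) (hT : 2 ≤ T) :
    1 / (2880 * (m : ℝ) * Real.logb 2 T ^ 4) ≤ 1 / 20 := by
  have hm' : (1 : ℝ) ≤ m := by exact_mod_cast hm
  have h := one_le_pow₀ (one_le_logb_two hT) (n := 4)
  refine one_div_le_one_div_of_le (by norm_num) ?_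
  nlinarith

/-- The regret bound of the first phase in terms of `m`, `n` and `T`. -/
theorem first_phase_bound_le {n : ℕ} (hm : 1 ≤ m) (hT : 2 ≤ T) (hn : 2 ≤ n) :
    Real.log n / (1 / (2880 * (m : ℝ) * Real.logb 2 T ^ 4)) +
      1 / (2880 * (m : ℝ) * Real.logb 2 T ^ 4) * (543 * (⌈Real.logb 2 T⌉₊ : ℝ) ^ 5) + 4 ≤
      3000 * (m * Real.logb 2 n * Real.logb 2 T ^ 4) := by
  have hm' : (1 : ℝ) ≤ m := by exact_mod_cast hm
  have hL := one_le_logb_two hT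
  have ha := one_le_logb_two hn
  have hc := pow_le_pow_left₀ (by positivity) (ceil_logb_le hT) 5
  have hlog := log_le_logb_two (n := n) (by omega)
  generalize Real.logb 2 T = L at *
  generalize Real.logb 2 n = a at *
  have hL4 : L ≤ L ^ 4 := le_self_pow₀ hL (by norm_num)
  have hma : 1 ≤ m * a := one_le_mul_of_one_le_of_one_le hm' ha
  have hX : L ≤ m * a * L ^ 4 := by
    calc L ≤ 1 * L ^ 4 := by linarith
      _ ≤ _ := mul_le_mul_of_nonneg_right hma (by positivity)
  have h1 : Real.log n / (1 / (2880 * (m : ℝ) * L ^ 4)) ≤ 2880 * (m * a * L ^ 4) := by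
    rw [div_div_eq_mul_div, div_one]
    calc Real.log n * (2880 * m * L ^ 4) ≤ a * (2880 * m * L ^ 4) := by gcongr
      _ = _ := by ring
  have h2 : 1 / (2880 * (m : ℝ) * L ^ 4) * (543 * (⌈L⌉₊ : ℝ) ^ 5) ≤ 10 * L := by
    rw [one_div_mul_eq_div, div_le_iff₀ (by positivity)]
    have h3 : 0 ≤ L ^ 5 := by positivity
    have h4 : L ^ 5 ≤ m * L ^ 5 := le_mul_of_one_le_left h3 hm'
    calc 543 * (⌈L⌉₊ : ℝ) ^ 5 ≤ 543 * (2 * L) ^ 5 := by gcongr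
      _ = 17376 * L ^ 5 := by ring
      _ ≤ 28800 * (m * L ^ 5) := by linarith
      _ = _ := by ring
  linarith

end StepSize

/-! ### Regret against arbitrary losses -/

section Adversarial

/-- Adversarial regret of the algorithm. -/
theorem regret_switchedOptHedge_le {m T n : ℕ} (hm : 1 ≤ m) (hT : 2 ≤ T) (hn : 2 ≤ n)
    {l : ℕ → Fin n → ℝ} (hl0 : l 0 = 0) (hl : ∀ t ≤ T, ∀ j, l t j ∈ Set.Icc (0 : ℝ) 1)
    (j : Fin n) :
    ∑ t ∈ Icc 1 T, ∑ k, switchedOptHedge 2880 543 m T n (lossHistory l (t - 1)) k * l t k -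
      ∑ t ∈ Icc 1 T, l t j ≤
      3000 * (m * Real.logb 2 n * Real.logb 2 T ^ 4) + 2 * √(T * Real.logb 2 n) := by
  have hη := stepSize_pos hm hT
  have hη1 := stepSize_le hm hT
  have hbound := first_phase_bound_le hm hT hn
  have hS : 0 ≤ √(T * Real.logb 2 n) := Real.sqrt_nonneg _
  by_cases hex : ∃ T₀, T₀ < T ∧ SwitchTest 543 (1 / (2880 * m * Real.logb 2 T ^ 4)) T l T₀
  · classical
    obtain ⟨hlt, htest⟩ := Nat.find_spec hex
    have hmin : ∀ T₁ < Nat.find hex,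
        ¬SwitchTest 543 (1 / (2880 * m * Real.logb 2 T ^ 4)) T l T₁ := fun T₁ h₁ hT₁ =>
      Nat.find_min hex h₁ ⟨by omega, hT₁⟩
    generalize Nat.find hex = T₀ at *
    -- Both phases are compared with the same fixed action `j`, so their bounds add up.
    obtain ⟨R, hR⟩ : ∃ R, T = T₀ + R := ⟨T - T₀, by omega⟩
    have p1 := regret_le_of_not_switchTest (by omega) (by norm_num) hη hη1 hl0
      (fun t (ht : t ≤ T₀) => hl t (by omega)) hmin j
    have p2 := regret_le_sqrt hn (l := fun s => if s = 0 then 0 else l (T₀ + s)) (by simp)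
      (by omega) (by omega : R ≤ T) (fun t ht k => by
        by_cases h : t = 0
        · simp [h]
        · simpa [h] using hl (T₀ + t) (by omega) k) j
    simp only [sum_Icc_one_eq_sum_range, Nat.add_sub_cancel] at p1 p2 ⊢
    have e : range T = range (T₀ + R) := by rw [hR]
    rw [e, sum_range_add, sum_range_add]
    have q1 : ∑ s ∈ range T₀, ∑ k, switchedOptHedge 2880 543 m T n (lossHistory l s) k *
        l (s + 1) k = ∑ s ∈ range T₀,
          ∑ k, optHedgeIter (1 / (2880 * m * Real.logb 2 T ^ 4)) l (s + 1) k * l (s + 1) k := by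
      refine sum_congr rfl fun s hs => ?_
      have hs' := mem_range.1 hs
      rw [switchedOptHedge_of_forall_not hl0 fun T₁ h₁ => hmin T₁ (by omega)]
    have q2 : ∀ s, switchedOptHedge 2880 543 m T n (lossHistory l (T₀ + s)) = _ := fun s =>
      switchedOptHedge_of_switchTest hl0 hmin htest s
    rw [q1]
    simp only [q2]
    simp only [Nat.succ_ne_zero, if_false, ← add_assoc] at p2
    linarith
  · push Not at hex
    have p1 := regret_le_of_not_switchTest (by omega) (by norm_num) hη hη1 hl0 hl hex j
    have q1 : ∑ t ∈ Icc 1 T, ∑ k, switchedOptHedge 2880 543 m T n (lossHistory l (t - 1)) k *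
        l t k = ∑ t ∈ Icc 1 T,
          ∑ k, optHedgeIter (1 / (2880 * m * Real.logb 2 T ^ 4)) l t k * l t k := by
      refine sum_congr rfl fun t ht => ?_
      have ht' := mem_Icc.1 ht
      rw [switchedOptHedge_of_forall_not hl0 fun T₁ h₁ => hex T₁ (by omega),
        Nat.sub_add_cancel ht'.1]
    rw [q1]
    linarith

end Adversarial

/-! ### Self-play never triggers the switch -/

section SelfPlay

variable {m : ℕ} {n : Fin m → ℕ}

/-- The losses when all players use Optimistic Hedge with step size `η` throughout. -/
noncomputable def Game.optHedgeLoss (G : Game m n) (η : ℝ) (i : Fin m) : ℕ → Fin (n i) → ℝ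
  | 0 => 0
  | t + 1 => G.lossVector (fun k => optHedge η (G.history (fun _ => optHedge η) t k)) i

/-- The next losses depend on everybody's strategies, so the histories of all players are identified
simultaneously; the hypothesis may use the agreement up to round `t`. -/
theorem Game.history_eq_lossHistory (G : Game m n) (A : ∀ k, OnlineAlgorithm (n k))
    (l : ∀ i, ℕ → Fin (n i) → ℝ) (T : ℕ)
    (h : ∀ t < T, (∀ k, G.history A t k = lossHistory (l k) t) →
      ∀ i, G.lossVector (fun k => A k (G.history A t k)) i = l i (t + 1))
    (t : ℕ) (ht : t ≤ T) (i : Fin m) : G.history A t i = lossHistory (l i) t := by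
  induction t generalizing i with
  | zero => rfl
  | succ t ih =>
    have h1 : lossHistory (l i) (t + 1) = lossHistory (l i) t ++ [l i (t + 1)] := by
      simp [lossHistory, List.range_succ]
    rw [h1, ← h t (by omega) (fun k => ih (by omega) k) i, ← ih (by omega) i]
    rfl

theorem Game.isOptHedgePlay_optHedgeLoss (G : Game m n) (η : ℝ) :
    G.IsOptHedgePlay η (G.optHedgeLoss η) where
  zero _ := rfl
  eq t i := by
    have h : ∀ k, G.history (fun _ => optHedge η) t k = lossHistory (G.optHedgeLoss η k) t :=
      G.history_eq_lossHistory _ _ t (fun _ _ _ _ => rfl) t le_rfl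
    change G.lossVector _ i = _
    congr 1
    funext k
    rw [h k, optHedge_lossHistory _ rfl]

/-- In self-play of the algorithm the switching test never succeeds, so that every player has
polylogarithmic regret. -/
theorem Game.playerRegret_switchedOptHedge_le (G : Game m n) (hm : 1 ≤ m) {T : ℕ} (hT : 2 ≤ T)
    (hn : ∀ i, 1 ≤ n i) (i : Fin m) (hni : 2 ≤ n i) :
    G.playerRegret (fun k => switchedOptHedge 2880 543 m T (n k)) T i ≤
      3000 * (m * Real.logb 2 (n i) * Real.logb 2 T ^ 4) := by
  have hη := stepSize_pos hm hT
  have hη1 := stepSize_le hm hT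
  have hηH := stepSize_mul_le hm hT
  have hbound := first_phase_bound_le hm hT hni
  have hTH := le_two_pow_ceil_logb hT
  have hL := one_le_logb_two hT
  have hH : 1 ≤ ⌈Real.logb 2 T⌉₊ := Nat.one_le_ceil_iff.2 (by linarith)
  have hH' : (1 : ℝ) ≤ ⌈Real.logb 2 T⌉₊ := by exact_mod_cast hH
  obtain ⟨l, hl⟩ : ∃ l, G.IsOptHedgePlay (1 / (2880 * (m : ℝ) * Real.logb 2 T ^ 4)) l :=
    ⟨_, G.isOptHedgePlay_optHedgeLoss _⟩
  have hpow : (⌈Real.logb 2 T⌉₊ : ℝ) ≤ (⌈Real.logb 2 T⌉₊ : ℝ) ^ 5 :=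
    le_self_pow₀ hH' (by norm_num)
  have hvar : ∀ k, ∀ T₀ ≤ T, _ := fun k T₀ (hT₀ : T₀ ≤ T) =>
    hl.sum_variance_le hn hm hH hη hηH (hT₀.trans hTH) k
  have hno : ∀ k, ∀ T₀ ≤ T,
      ¬SwitchTest 543 (1 / (2880 * (m : ℝ) * Real.logb 2 T ^ 4)) T (l k) T₀ := by
    rintro k T₀ hT₀ ⟨-, hlt⟩
    have := hvar k T₀ hT₀
    linarith
  have hstrat : ∀ t ≤ T, ∀ k, switchedOptHedge 2880 543 m T (n k) (lossHistory (l k) t) =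
      optHedgeIter (1 / (2880 * (m : ℝ) * Real.logb 2 T ^ 4)) (l k) (t + 1) := fun t ht k =>
    switchedOptHedge_of_forall_not (hl.zero k) fun T₀ hT₀ => hno k T₀ (by omega)
  -- As long as the histories agree with plain Optimistic Hedge play, no player's test has
  -- succeeded, so all strategies, and thus the next losses, agree too.
  have hloss : ∀ t < T,
      (∀ k, G.history (fun k => switchedOptHedge 2880 543 m T (n k)) t k =
        lossHistory (l k) t) →
      ∀ i, G.lossVector (fun k => switchedOptHedge 2880 543 m T (n k)
        (G.history (fun k => switchedOptHedge 2880 543 m T (n k)) t k)) i = l i (t + 1) := by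
    intro t ht h i
    rw [hl.eq]
    congr 1
    funext k
    rw [h k, hstrat t ht.le k]
  have hhist := G.history_eq_lossHistory _ l T hloss
  refine regret_le_of_forall (hn i) fun j => ?_
  have p1 := regret_le_of_variation_le (hn i) hη hη1 (hl.zero i)
    (fun t (_ : t ≤ T) => hl.mem_Icc hn i t) (by positivity) (hvar i T le_rfl) j
  rw [sum_Icc_one_eq_sum_range, sum_Icc_one_eq_sum_range] at p1 ⊢
  have q1 : ∀ s ∈ range T, G.lossVector
      (G.strategy (fun k => switchedOptHedge 2880 543 m T (n k)) (s + 1)) i = l i (s + 1) :=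
    fun s hs => hloss s (mem_range.1 hs) (fun k => hhist s (mem_range.1 hs).le k) i
  have q2 : ∀ s ∈ range T,
      G.strategy (fun k => switchedOptHedge 2880 543 m T (n k)) (s + 1) i =
        optHedgeIter (1 / (2880 * (m : ℝ) * Real.logb 2 T ^ 4)) (l i) (s + 1) := fun s hs => by
    rw [Game.strategy, Nat.add_sub_cancel, hhist s (mem_range.1 hs).le i,
      hstrat s (mem_range.1 hs).le i]
  have h5 := mul_le_mul_of_nonneg_left hpow hη.le
  refine le_trans (le_of_eq ?_) (p1.trans (by linarith))
  refine congrArg₂ _ (sum_congr rfl fun s hs => ?_) (sum_congr rfl fun s hs => ?_)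
  · rw [q1 s hs, q2 s hs]
  · rw [q1 s hs]

end SelfPlay

end LearningInGames

open LearningInGames in
theorem corollaryD1 :
    ∃ C > (0 : ℝ), ∃ C' > (0 : ℝ), ∃ K > (0 : ℝ), ∀ m T : ℕ, 1 ≤ m → 2 ≤ T →
      (∀ n : Fin m → ℕ, (∀ i, 1 ≤ n i) → ∀ (G : Game m n) (i : Fin m),
        G.playerRegret (fun k => switchedOptHedge C C' m T (n k)) T i
          ≤ K * (m * Real.logb 2 (n i) * Real.logb 2 T ^ 4)) ∧
      (∀ n : ℕ, 1 ≤ n → ∀ l : ℕ → Fin n → ℝ,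
        (∀ t ∈ Finset.Icc 1 T, ∀ j, l t j ∈ Set.Icc (0 : ℝ) 1) →
        regret (strategyAgainst (switchedOptHedge C C' m T n) l) l T
          ≤ K * (m * Real.logb 2 n * Real.logb 2 T ^ 4 + Real.sqrt (T * Real.logb 2 n))) := by
  -- `543` is the constant of the variation bound, and `3000` covers the first-phase total `2880 +
  -- 10 + 4` as well as the `2` before the square root.
  refine ⟨2880, by norm_num, 543, by norm_num, 3000, by norm_num, fun m T hm hT => ⟨?_, ?_⟩⟩
  · intro n hn G i
    rcases (hn i).eq_or_lt with h1 | h1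
    · refine (regret_le_zero_of_eq_one h1.symm
        (fun t => (switchedOptHedge_mem_stdSimplex (hn i) _ _ _ _ _).2) _ T).trans ?_
      rw [← h1]
      simp
    · exact G.playerRegret_switchedOptHedge_le hm hT hn i h1
  · intro n hn l hl
    rcases hn.eq_or_lt with h1 | h1
    · refine (regret_le_zero_of_eq_one h1.symm
        (fun t => (switchedOptHedge_mem_stdSimplex hn _ _ _ _ _).2) _ T).trans ?_
      rw [← h1]
      simp
    · refine regret_le_of_forall hn fun j => ?_
      -- The given sequence is arbitrary at index `0`; neither the regret nor the histories read
      -- that entry, so it is reset to `0`.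
      have key := regret_switchedOptHedge_le hm hT h1 (l := fun t => if t = 0 then 0 else l t)
        (by simp) (fun t ht k => by
          by_cases h : t = 0
          · simp [h]
          · simpa [h] using hl t (Finset.mem_Icc.2 ⟨by omega, ht⟩) k) j
      have hhist : ∀ t, lossHistory (fun t => if t = 0 then 0 else l t) (t - 1) =
          (List.range (t - 1)).map fun s => l (s + 1) := fun t => by simp [lossHistory]
      simp only [sum_Icc_one_eq_sum_range, hhist, Nat.succ_ne_zero, if_false] at key ⊢
      have hS : 0 ≤ √(T * Real.logb 2 n) := Real.sqrt_nonneg _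
      simp only [strategyAgainst]
      linarith
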